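/- Let $\rho,\rho'$ be density operators on a finite-dimensional complex Hilbert space $\mathcal H$, and write $\|A\|=\tfrac12\operatorname{tr}|A|$ with $|A|=\sqrt{A^\dagger A}$, so that $\|\rho-\rho'\|$ is the trace distance. A \emph{perfect purifier} of $\{\rho,\rho'\}$ is a completely positive trace-preserving linear map $\Lambda$ from operators on $\mathcal H$ to operators on $\mathcal H\otimes\mathcal H_{\rm aux}$, for some finite-dimensional auxiliary Hilbert space $\mathcal H_{\rm aux}$ of arbitrary dimension, such that for each $\sigma\in\{\rho,\rho'\}$ the output $\Lambda[\sigma]$ is a pure state and $\operatorname{tr}_{\rm aux}\Lambda[\sigma]=\sigma$. Let $$D(\rho,\rho')=\min_{|\chi\rangle,|\chi'\rangle}\big\|\,|\chi\rangle\langle\chi|-|\chi'\rangle\langle\chi'|\,\big\|,$$ over all unit vectors $|\chi\rangle$ in the range of $\rho$ and $|\chi'\rangle$ in the range of $\rho'$, and let $F(\rho,\rho')=\operatorname{tr}\sqrt{\sqrt\rho\,\rho'\sqrt\rho}$ be the Uhlmann fidelity. Then: (a) The minimum defining $D(\rho,\rho')$ is attained and equals $\sin\theta$, where $\theta\in[0,\pi/2]$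 is the smallest canonical angle between the ranges of $\rho$ and $\rho'$ (that is, $\cos\theta$ is the largest singular value of $Y^\dagger X$, where the columns of $X$ and $Y$ are orthonormal bases of the ranges of $\rho$ and $\rho'$, respectively). (b) A perfect purifier of $\{\rho,\rho'\}$ exists if and only if $\|\rho-\rho'\|=D(\rho,\rho')$. (c) Let $0<\eta\le\eta'$ with $\eta+\eta'=1$, and let $\delta_{\rm opt}$ be the infimum of $$\delta=\eta\,\|\rho-\operatorname{tr}_{\rm aux}\Lambda[\rho]\|+\eta'\,\|\rho'-\operatorname{tr}_{\rm aux}\Lambda[\rho']\|$$ over all completely positive trace-preserving $\Lambda$ as above (for any finite-dimensional $\mathcal H_{\rm aux}$) for which $\Lambda[\rho]$ and $\Lambda[\rho']$ are both pure. Let $\alpha,\beta\in[0,\pi/2]$ be defined by $\sin\alpha=D(\rho,\rho')$ and $\cos\beta=F(\rho,\rho')$. Then $\delta_{\rm opt}\le\eta\sin(\beta-\alpha)$, and this upper bound $\eta\sin(\beta-\alpha)$ equals $0$ if and only if a perfect purifier of $\{\rho,\rho'\}$ exists. -/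

import Mathlib

open scoped ComplexOrder MatrixOrder Matrix.Norms.L2Operator CStarAlgebra

namespace Purification

noncomputable section

/-- A quantum state (density operator) on the Hilbert space `ℂⁿ`. -/
def IsState {n : Type*} [Fintype n] (ρ : Matrix n n ℂ) : Prop :=
  ρ.PosSemidef ∧ ρ.trace = 1

/-- The rank-one operator `|χ⟩⟨χ|`. -/
def proj {n : Type*} (χ : EuclideanSpace ℂ n) : Matrix n n ℂ :=
  Matrix.vecMulVec χ.ofLp (star χ.ofLp)

/-- A pure state: `|χ⟩⟨χ|` for a unit vector `χ`. -/
def IsPureState {n : Type*} [Fintype n] (σ : Matrix n n ℂ) : Prop :=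
  ∃ χ : EuclideanSpace ℂ n, ‖χ‖ = 1 ∧ σ = proj χ

/-- The trace distance `(1/2) tr |ρ - σ|`, where `|A| = √(A† A)`. -/
def traceDist {n : Type*} [Fintype n] [DecidableEq n] (ρ σ : Matrix n n ℂ) : ℝ :=
  (1 / 2) * (CFC.abs (ρ - σ)).trace.re

/-- The Uhlmann fidelity `tr √(√ρ ρ' √ρ)`. -/
def fidelity {n : Type*} [Fintype n] [DecidableEq n] (ρ ρ' : Matrix n n ℂ) : ℝ :=
  (CFC.sqrt (CFC.sqrt ρ * ρ' * CFC.sqrt ρ)).trace.re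

/-- The partial trace over the second (auxiliary) tensor factor. -/
def trAux {n a : Type*} [Fintype a] (X : Matrix (n × a) (n × a) ℂ) : Matrix n n ℂ :=
  Matrix.of fun i j => ∑ s, X (i, s) (j, s)

/-- Deterministic physical processes (channels): completely positive maps that are also
trace preserving. -/
def IsTracePreserving {n m : Type*} [Fintype n] [DecidableEq n] [Fintype m] [DecidableEq m]
    (Λ : Matrix n n ℂ →CP Matrix m m ℂ) : Prop :=
  ∀ X : Matrix n n ℂ, (Λ X).trace = X.trace

/-- A channel `Λ` into the composite with an auxiliary space `ℂᵈ` is a perfect purifier of the set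
`M` if each output is pure and faithful. -/
def IsPerfectPurifier {n : Type*} [Fintype n] [DecidableEq n] {d : ℕ}
    (Λ : Matrix n n ℂ →CP Matrix (n × Fin d) (n × Fin d) ℂ) (M : Set (Matrix n n ℂ)) : Prop :=
  IsTracePreserving Λ ∧ ∀ ρ ∈ M, IsPureState (Λ ρ) ∧ trAux (Λ ρ) = ρ

/-- The set `M` admits a perfect purifier, with an auxiliary space of some dimension. -/
def AdmitsPerfectPurifier {n : Type*} [Fintype n] [DecidableEq n]
    (M : Set (Matrix n n ℂ)) : Prop :=
  ∃ (d : ℕ) (Λ : Matrix n n ℂ →CP Matrix (n × Fin d) (n × Fin d) ℂ), IsPerfectPurifier Λ M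

/-- The range of a matrix, acting as an operator on `ℂⁿ`. -/
def rangeOf {n : Type*} [Fintype n] [DecidableEq n] (ρ : Matrix n n ℂ) :
    Submodule ℂ (EuclideanSpace ℂ n) :=
  LinearMap.range (Matrix.toEuclideanLin ρ)

/-- The trace distances between pure states taken from the ranges of `ρ` and `ρ'`. -/
def pureDistances {n : Type*} [Fintype n] [DecidableEq n] (ρ ρ' : Matrix n n ℂ) : Set ℝ :=
  {t | ∃ χ ∈ rangeOf ρ, ∃ χ' ∈ rangeOf ρ', ‖χ‖ = 1 ∧ ‖χ'‖ = 1 ∧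
    t = traceDist (proj χ) (proj χ')}

/-- The worst-case distinguishability `D(ρ, ρ')`. -/
def worstCaseDist {n : Type*} [Fintype n] [DecidableEq n] (ρ ρ' : Matrix n n ℂ) : ℝ :=
  sInf (pureDistances ρ ρ')

/-- The canonical (principal) angles between two subspaces: the cosines are the singular values of
the orthogonal projection onto `V` restricted to `U`, i.e. of the matrix `Y† X` for orthonormal
bases `X` of `U` and `Y` of `V`. Singular values are listed in decreasing order, so the
angles are listed in increasing order and the one with index `0` is the smallest. (Only the indices
below the smaller one of the two dimensions are meaningful.) -/
def canonicalAngle {E : Type*} [NormedAddCommGroup E] [InnerProductSpace ℂ E]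
    [FiniteDimensional ℂ E] (U V : Submodule ℂ E) (i : ℕ) : ℝ :=
  Real.arccos
    ((V.orthogonalProjectionOnto.toLinearMap ∘ₗ U.subtype : U →ₗ[ℂ] V).singularValues i)

/-- The deviation from perfect faithfulness of `Λ` on `ρ`, `ρ'` with probabilities `η`, `η'`. -/
def deviation {n : Type*} [Fintype n] [DecidableEq n] {d : ℕ}
    (Λ : Matrix n n ℂ →CP Matrix (n × Fin d) (n × Fin d) ℂ)
    (η η' : ℝ) (ρ ρ' : Matrix n n ℂ) : ℝ :=
  η * traceDist ρ (trAux (Λ ρ)) + η' * traceDist ρ' (trAux (Λ ρ'))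

/-- The optimal deviation `δ_opt`: the infimum of the deviation over all deterministic processes
that take both states to pure states. -/
def optDeviation {n : Type*} [Fintype n] [DecidableEq n]
    (η η' : ℝ) (ρ ρ' : Matrix n n ℂ) : ℝ :=
  sInf {δ | ∃ (d : ℕ) (Λ : Matrix n n ℂ →CP Matrix (n × Fin d) (n × Fin d) ℂ),
    IsTracePreserving Λ ∧ IsPureState (Λ ρ) ∧ IsPureState (Λ ρ') ∧ δ = deviation Λ η η' ρ ρ'}

/-- The fidelity upper bound `η sin(β - α)` on `δ_opt`, where `sin α = D(ρ, ρ')` and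
`cos β = F(ρ, ρ')` with `α, β ∈ [0, π/2]`. -/
def fidelityBound {n : Type*} [Fintype n] [DecidableEq n]
    (η : ℝ) (ρ ρ' : Matrix n n ℂ) : ℝ :=
  η * Real.sin (Real.arccos (fidelity ρ ρ') - Real.arcsin (worstCaseDist ρ ρ'))

end

end Purification

/-! Let c be the largest overlap |⟨u, v⟩| of unit vectors u, v from the two ranges. It is the top
singular value of the projection onto one range restricted to the other, so D = √(1 - c²) = sin θ,
and the rest compares c with the fidelity F and with the trace distance.

The engine is a dilation (`exists_dilation`). For the support projections P, Q, the product QP is c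
times a contraction, and this yields, for all unit vectors with ⟨Ψ, Ψ'⟩ = c, an isometry W with WρW†
= |Ψ⟩⟨Ψ| ⊗ r and Wρ'W† = |Ψ'⟩⟨Ψ'| ⊗ r'. Discarding r and r' gives a channel to Ψ and Ψ'. Conversely,
a channel that is pure on ρ has the same output on every pure state in its range
(`channel_proj_eq`), so contractivity forces output overlap at least c.

Always F ≤ c (`fidelity_le`). The outputs of a perfect purifier are purifications, so c ≤ overlap ≤
F by Uhlmann. If F = c, the dilation maps ρ, ρ' to Uhlmann-optimal purifications. Thus a perfect
purifier exists iff F = c.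

For the trace distance (`traceDist_ge`), dilate to qubit states on which σ_z is an optimal test:
this gives ‖ρ - ρ'‖ ≥ D, and equality forces r = r' when c > 0, hence purifications with overlap c
and F = c. For (c), keep an optimal purification of ρ' and rotate that of ρ until the overlap is c.
-/

namespace Purification

open Matrix
open scoped Kronecker

/-! ### Traces of products of positive matrices. -/

section MatrixPreliminaries

variable {m n k : Type*} [Fintype m] [Fintype n] [Fintype k]

theorem re_trace_conjTranspose_mul_self_nonneg (X : Matrix m n ℂ) : 0 ≤ (Xᴴ * X).trace.re :=
  (Complex.le_def.1 (posSemidef_conjTranspose_mul_self X).trace_nonneg).1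

theorem re_trace_conjTranspose_mul_self (X : Matrix m n ℂ) :
    (Xᴴ * X).trace.re = ∑ j, ∑ i, ‖X i j‖ ^ 2 := by
  simp only [trace, diag_apply, mul_apply, conjTranspose_apply, Complex.re_sum]
  refine Finset.sum_congr rfl fun j _ => Finset.sum_congr rfl fun i _ => ?_
  rw [Complex.star_def, Complex.conj_mul']
  norm_cast

/-- Entrywise AM-GM; this additive form replaces Cauchy-Schwarz throughout. -/
theorem norm_trace_conjTranspose_mul_le (X Y : Matrix m n ℂ) :
    ‖(Xᴴ * Y).trace‖ ≤ ((Xᴴ * X).trace.re + (Yᴴ * Y).trace.re) / 2 := by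
  rw [re_trace_conjTranspose_mul_self, re_trace_conjTranspose_mul_self, ← Finset.sum_add_distrib,
    Finset.sum_div]
  simp only [trace, diag_apply, mul_apply, conjTranspose_apply]
  refine (norm_sum_le _ _).trans (Finset.sum_le_sum fun j _ => ?_)
  rw [← Finset.sum_add_distrib, Finset.sum_div]
  refine (norm_sum_le _ _).trans (Finset.sum_le_sum fun i _ => ?_)
  rw [norm_mul, norm_star]
  nlinarith [sq_nonneg (‖X i j‖ - ‖Y i j‖)]

theorem exists_eq_mul_conjTranspose [DecidableEq n] {A : Matrix n n ℂ} (hA : A.PosSemidef) :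
    ∃ B : Matrix n n ℂ, A = B * Bᴴ := by
  obtain ⟨B, hB⟩ := CStarAlgebra.nonneg_iff_eq_star_mul_self.mp hA.nonneg
  exact ⟨Bᴴ, by rw [conjTranspose_conjTranspose]; exact hB⟩

theorem re_trace_mul_nonneg [DecidableEq n] {A B : Matrix n n ℂ} (hA : A.PosSemidef)
    (hB : B.PosSemidef) : 0 ≤ (A * B).trace.re := by
  obtain ⟨C, rfl⟩ := exists_eq_mul_conjTranspose hB
  rw [← Matrix.mul_assoc, trace_mul_comm, ← Matrix.mul_assoc]
  exact (Complex.le_def.1 (hA.conjTranspose_mul_mul_same C).trace_nonneg).1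

/-- With A = DD† and B = CC†, the trace is the squared Hilbert-Schmidt norm of D†C. -/
theorem mul_eq_zero_of_re_trace_mul_eq_zero [DecidableEq n] {A B : Matrix n n ℂ}
    (hA : A.PosSemidef) (hB : B.PosSemidef) (h : (A * B).trace.re = 0) : A * B = 0 := by
  obtain ⟨C, rfl⟩ := exists_eq_mul_conjTranspose hB
  obtain ⟨D, rfl⟩ := exists_eq_mul_conjTranspose hA
  have h1 : (D * Dᴴ * (C * Cᴴ)).trace = ((Dᴴ * C)ᴴ * (Dᴴ * C)).trace := by
    rw [conjTranspose_mul, conjTranspose_conjTranspose, ← Matrix.mul_assoc, trace_mul_comm,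
      ← Matrix.mul_assoc, ← Matrix.mul_assoc, ← Matrix.mul_assoc]
  have h2 := (posSemidef_conjTranspose_mul_self (Dᴴ * C)).trace_nonneg
  have h3 : ((Dᴴ * C)ᴴ * (Dᴴ * C)).trace = 0 :=
    Complex.ext (by rw [← h1, h]; rfl) (Complex.le_def.1 h2).2.symm
  rw [trace_conjTranspose_mul_self_eq_zero_iff] at h3
  rw [Matrix.mul_assoc, ← Matrix.mul_assoc Dᴴ, h3, Matrix.zero_mul, Matrix.mul_zero]

end MatrixPreliminaries

/-! ### Variational description of the trace norm. -/

section TraceNorm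

variable {n m : Type*} [Fintype n] [DecidableEq n] [Fintype m] [DecidableEq m]

/-- The sign of a Hermitian matrix is an optimal test for its trace norm. -/
theorem exists_mul_eq_abs {A : Matrix n n ℂ} (hA : A.IsHermitian) :
    ∃ S : Matrix n n ℂ, (1 - S).PosSemidef ∧ (1 + S).PosSemidef ∧ S * A = CFC.abs A := by
  have hs : IsSelfAdjoint A := hA
  have hc : ∀ f : ℝ → ℝ, ContinuousOn f (spectrum ℝ A) := fun f =>
    (Matrix.finite_real_spectrum (A := A)).continuousOn f
  refine ⟨cfc (fun x : ℝ => (SignType.sign x : ℝ)) A, ?_, ?_, ?_⟩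
  · rw [← nonneg_iff_posSemidef, sub_nonneg]
    refine cfc_le_one _ _ fun x _ => ?_
    rcases lt_trichotomy x 0 with h | h | h <;> simp [h]
  · have h1 : (1 : Matrix n n ℂ) + cfc (fun x : ℝ => (SignType.sign x : ℝ)) A =
        cfc (fun x : ℝ => 1 + (SignType.sign x : ℝ)) A := by
      rw [cfc_add (a := A) (fun _ => (1 : ℝ)) _ (hc _) (hc _), cfc_const_one ℝ A]
    rw [h1, ← nonneg_iff_posSemidef]
    refine cfc_nonneg fun x _ => ?_
    rcases lt_trichotomy x 0 with h | h | h <;> simp [h]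
  · rw [CFC.abs_eq_cfc_norm A hs]
    conv_lhs => rw [← cfc_id' ℝ A]
    conv_lhs => enter [1]; rw [cfc_id' ℝ A]
    rw [← cfc_mul _ _ A (hc _) (hc _)]
    refine cfc_congr fun x _ => ?_
    simp

theorem re_trace_abs_sub_le {P Q : Matrix n n ℂ} (hP : P.PosSemidef) (hQ : Q.PosSemidef) :
    (CFC.abs (P - Q)).trace.re ≤ P.trace.re + Q.trace.re := by
  obtain ⟨S, h1, h2, h3⟩ := exists_mul_eq_abs (hP.1.sub hQ.1)
  have h4 := re_trace_mul_nonneg h1 hP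
  have h5 := re_trace_mul_nonneg h2 hQ
  rw [← h3]
  simp only [sub_mul, add_mul, mul_sub, one_mul, trace_sub, trace_add, Complex.sub_re,
    Complex.add_re] at h4 h5 ⊢
  linarith

theorem posPart_posSemidef (A : Matrix n n ℂ) : (A⁺).PosSemidef :=
  nonneg_iff_posSemidef.1 (CFC.posPart_nonneg A)

theorem negPart_posSemidef (A : Matrix n n ℂ) : (A⁻).PosSemidef :=
  nonneg_iff_posSemidef.1 (CFC.negPart_nonneg A)

theorem re_trace_abs_eq {A : Matrix n n ℂ} (hA : A.IsHermitian) :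
    (CFC.abs A).trace.re = (A⁺).trace.re + (A⁻).trace.re := by
  rw [← CFC.posPart_add_negPart A hA, trace_add, Complex.add_re]

theorem re_trace_mul_le_abs {A Z : Matrix n n ℂ} (hA : A.IsHermitian) (h1 : (1 - Z).PosSemidef)
    (h2 : (1 + Z).PosSemidef) : (Z * A).trace.re ≤ (CFC.abs A).trace.re := by
  have h4 := re_trace_mul_nonneg h1 (posPart_posSemidef A)
  have h5 := re_trace_mul_nonneg h2 (negPart_posSemidef A)
  rw [re_trace_abs_eq hA]
  conv_lhs => rw [← CFC.posPart_sub_negPart A hA]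
  simp only [sub_mul, add_mul, mul_sub, one_mul, trace_sub, trace_add, Complex.sub_re,
    Complex.add_re] at h4 h5 ⊢
  linarith

/-- An optimal test Z must act as 1 on A⁺ and as -1 on A⁻: both nonnegative slacks in the trace
inequality vanish, hence so do the products themselves. -/
theorem mul_eq_abs_of_re_trace_eq {A Z : Matrix n n ℂ} (hA : A.IsHermitian)
    (h1 : (1 - Z).PosSemidef) (h2 : (1 + Z).PosSemidef)
    (h : (CFC.abs A).trace.re ≤ (Z * A).trace.re) : Z * A = CFC.abs A := by
  have h4 := re_trace_mul_nonneg h1 (posPart_posSemidef A)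
  have h5 := re_trace_mul_nonneg h2 (negPart_posSemidef A)
  have e4 : ((1 - Z) * A⁺).trace.re = (A⁺).trace.re - (Z * A⁺).trace.re := by
    simp [sub_mul]
  have e5 : ((1 + Z) * A⁻).trace.re = (A⁻).trace.re + (Z * A⁻).trace.re := by
    simp [add_mul]
  have e : (Z * A).trace.re = (Z * A⁺).trace.re - (Z * A⁻).trace.re := by
    conv_lhs => rw [← CFC.posPart_sub_negPart A hA]
    simp [mul_sub]
  rw [re_trace_abs_eq hA] at h
  have h6 := mul_eq_zero_of_re_trace_mul_eq_zero h1 (posPart_posSemidef A) (by linarith)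
  have h7 := mul_eq_zero_of_re_trace_mul_eq_zero h2 (negPart_posSemidef A) (by linarith)
  rw [sub_mul, one_mul, sub_eq_zero] at h6
  rw [add_mul, one_mul, add_eq_zero_iff_eq_neg] at h7
  conv_lhs => rw [← CFC.posPart_sub_negPart A hA]
  rw [mul_sub, ← h6, ← CFC.posPart_add_negPart A hA, sub_eq_add_neg, ← h7]

theorem traceDist_nonneg (ρ σ : Matrix n n ℂ) : 0 ≤ traceDist ρ σ := by
  have h := (nonneg_iff_posSemidef.1 (CFC.abs_nonneg (ρ - σ))).trace_nonneg
  have := (Complex.le_def.1 h).1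
  simp only [Complex.zero_re] at this
  unfold traceDist
  positivity

/-- Contractivity of the trace distance under positive trace-preserving linear maps. -/
theorem traceDist_map_le (f : Matrix n n ℂ →ₗ[ℂ] Matrix m m ℂ)
    (hpos : ∀ X : Matrix n n ℂ, X.PosSemidef → (f X).PosSemidef)
    (htr : ∀ X : Matrix n n ℂ, (f X).trace = X.trace) {ρ σ : Matrix n n ℂ}
    (h : (ρ - σ).IsHermitian) : traceDist (f ρ) (f σ) ≤ traceDist ρ σ := by
  -- The images of the Jordan parts of ρ - σ are positive with the same traces, though no longer
  -- orthogonal in general.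
  have h1 := re_trace_abs_sub_le (hpos _ (posPart_posSemidef (ρ - σ)))
    (hpos _ (negPart_posSemidef (ρ - σ)))
  rw [← map_sub, CFC.posPart_sub_negPart _ h, htr, htr, ← re_trace_abs_eq h, map_sub] at h1
  unfold traceDist
  linarith

end TraceNorm

/-! ### Pure states. -/

section Proj

variable {n : Type*} [Fintype n]

theorem proj_posSemidef (χ : EuclideanSpace ℂ n) : (proj χ).PosSemidef :=
  posSemidef_vecMulVec_self_star _

theorem star_dotProduct_self (χ : EuclideanSpace ℂ n) :
    star χ.ofLp ⬝ᵥ χ.ofLp = ((‖χ‖ ^ 2 : ℝ) : ℂ) := by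
  rw [dotProduct_comm, ← EuclideanSpace.inner_eq_star_dotProduct, inner_self_eq_norm_sq_to_K]
  norm_cast

theorem trace_proj (χ : EuclideanSpace ℂ n) : (proj χ).trace = ((‖χ‖ ^ 2 : ℝ) : ℂ) := by
  rw [proj, trace_vecMulVec, dotProduct_comm, star_dotProduct_self]

theorem proj_mul_proj_mul_proj (χ ψ : EuclideanSpace ℂ n) :
    proj χ * proj ψ * proj χ = ((‖inner ℂ χ ψ‖ ^ 2 : ℝ) : ℂ) • proj χ := by
  have h1 : star χ.ofLp ⬝ᵥ ψ.ofLp = inner ℂ χ ψ := by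
    rw [dotProduct_comm, ← EuclideanSpace.inner_eq_star_dotProduct]
  have h2 : star ψ.ofLp ⬝ᵥ χ.ofLp = inner ℂ ψ χ := by
    rw [dotProduct_comm, ← EuclideanSpace.inner_eq_star_dotProduct]
  rw [proj, proj, vecMulVec_mul_vecMulVec, vecMulVec_mul_vecMulVec, smul_dotProduct, h1, h2,
    smul_eq_mul, ← inner_conj_symm ψ χ, Complex.mul_conj']
  push_cast
  rw [vecMulVec_smul]

theorem trace_proj_mul_proj (χ ψ : EuclideanSpace ℂ n) :
    (proj χ * proj ψ).trace = ((‖inner ℂ χ ψ‖ ^ 2 : ℝ) : ℂ) := by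
  have h1 : star χ.ofLp ⬝ᵥ ψ.ofLp = inner ℂ χ ψ := by
    rw [dotProduct_comm, ← EuclideanSpace.inner_eq_star_dotProduct]
  have h2 : χ.ofLp ⬝ᵥ star ψ.ofLp = inner ℂ ψ χ := by
    rw [← EuclideanSpace.inner_eq_star_dotProduct]
  rw [proj, proj, vecMulVec_mul_vecMulVec, trace_vecMulVec, dotProduct_smul, h1, h2,
    smul_eq_mul, ← inner_conj_symm ψ χ, Complex.mul_conj']
  push_cast
  rfl

theorem proj_mul_self {χ : EuclideanSpace ℂ n} (h : ‖χ‖ = 1) : proj χ * proj χ = proj χ := by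
  rw [proj, vecMulVec_mul_vecMulVec, star_dotProduct_self, h]
  simp

variable [DecidableEq n]

/-- The trace distance of two pure states. -/
theorem traceDist_proj {χ ψ : EuclideanSpace ℂ n} (hχ : ‖χ‖ = 1) (hψ : ‖ψ‖ = 1) :
    traceDist (proj χ) (proj ψ) = √(1 - ‖inner ℂ χ ψ‖ ^ 2) := by
  set p := proj χ with hp
  set q := proj ψ with hq
  set c := ‖inner ℂ χ ψ‖ with hc
  have hpp : p * p = p := proj_mul_self hχ
  have hqq : q * q = q := proj_mul_self hψ
  have hpqp : p * q * p = ((c ^ 2 : ℝ) : ℂ) • p := proj_mul_proj_mul_proj χ ψ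
  have hqpq : q * p * q = ((c ^ 2 : ℝ) : ℂ) • q := by
    rw [hp, hq, hc, norm_inner_symm]; exact proj_mul_proj_mul_proj ψ χ
  have hA : (p - q)ᴴ = p - q := (proj_posSemidef χ).1.sub (proj_posSemidef ψ).1
  have hc1 : c ≤ 1 := by
    simpa [hχ, hψ] using norm_inner_le_norm (𝕜 := ℂ) χ ψ
  have hc2 : 0 ≤ 1 - c ^ 2 := by nlinarith [norm_nonneg (inner ℂ χ ψ)]
  have hsq : (p - q) * (p - q) = p + q - p * q - q * p := by
    simp only [sub_mul, mul_sub, hpp, hqq]; abel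
  have htr : ((p - q) * (p - q)).trace = ((2 * (1 - c ^ 2) : ℝ) : ℂ) := by
    rw [hsq, trace_sub, trace_sub, trace_add, trace_mul_comm q p, trace_proj_mul_proj,
      trace_proj, trace_proj, hχ, hψ]
    push_cast; ring
  -- So the nonzero eigenvalues of p - q are among ±s with s = √(1 - c²), and |p - q| = (p - q)² / s
  -- when s ≠ 0.
  have hcube : (p - q) * (p - q) * (p - q) = ((1 - c ^ 2 : ℝ) : ℂ) • (p - q) := by
    have e1 : p * q * q = p * q := by rw [mul_assoc, hqq]
    have e2 : q * p * p = q * p := by rw [mul_assoc, hpp]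
    rw [hsq]
    simp only [sub_mul, mul_sub, add_mul, hpp, hqq, hpqp, hqpq, e1, e2]
    push_cast
    module
  rcases hc2.eq_or_lt with h0 | h0
  · rw [← h0, mul_zero, Complex.ofReal_zero] at htr
    have : p - q = 0 := by
      rw [← trace_conjTranspose_mul_self_eq_zero_iff, hA, htr]
    rw [traceDist, this, ← h0]
    simp
  · set s := √(1 - c ^ 2) with hs
    have hs0 : 0 < s := Real.sqrt_pos.2 h0
    have hss : s * s = 1 - c ^ 2 := Real.mul_self_sqrt hc2
    have habs : CFC.abs (p - q) = ((s⁻¹ : ℝ) : ℂ) • ((p - q) * (p - q)) := by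
      rw [CFC.abs]
      refine CFC.sqrt_unique ?_ ?_
      · rw [star_eq_conjTranspose, hA, smul_mul_smul_comm, ← mul_assoc, hcube, smul_mul_assoc,
          smul_smul, ← hss, ← Complex.ofReal_mul, ← Complex.ofReal_mul]
        have : s⁻¹ * s⁻¹ * (s * s) = 1 := by field_simp
        rw [this]; simp
      · have h2 : ((p - q) * (p - q)).PosSemidef := by
          nth_rw 1 [← hA]
          exact posSemidef_conjTranspose_mul_self _
        exact (h2.smul (Complex.zero_le_real.2 (inv_nonneg.2 hs0.le))).nonneg
    rw [traceDist, habs, trace_smul, htr, ← hss, smul_eq_mul, ← Complex.ofReal_mul,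
      Complex.ofReal_re]
    field_simp

/-- A positive operator below a rank-one projection is a multiple of it. -/
theorem eq_smul_proj_of_le {ψ : EuclideanSpace ℂ n} (hψ : ‖ψ‖ = 1) {X : Matrix n n ℂ}
    (h0 : X.PosSemidef) (h1 : (proj ψ - X).PosSemidef) : X = X.trace • proj ψ := by
  obtain ⟨C, rfl⟩ := exists_eq_mul_conjTranspose h0
  set p := proj ψ with hp
  have hpp : p * p = p := proj_mul_self hψ
  have hpH : pᴴ = p := (proj_posSemidef ψ).1
  -- Compressing by 1 - p kills p and leaves minus a positive matrix, so C†(1 - p) = 0.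
  have h2 := h1.conjTranspose_mul_mul_same (1 - p)
  have h3 : (1 - p)ᴴ * (p - C * Cᴴ) * (1 - p) = - ((Cᴴ * (1 - p))ᴴ * (Cᴴ * (1 - p))) := by
    have : (1 - p) * p = 0 := by rw [sub_mul, one_mul, hpp, sub_self]
    have h4 : (1 - p)ᴴ = 1 - p := by rw [conjTranspose_sub, conjTranspose_one, hpH]
    rw [conjTranspose_mul, h4, mul_sub (1 - p) p, this, conjTranspose_conjTranspose]
    simp only [zero_sub, neg_mul, mul_assoc]
  rw [h3] at h2
  have h5 : Cᴴ * (1 - p) = 0 := by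
    rw [← conjTranspose_mul_self_eq_zero]
    exact le_antisymm (neg_nonneg.1 h2.nonneg) (posSemidef_conjTranspose_mul_self _).nonneg
  have h6 : Cᴴ = Cᴴ * p := by rwa [mul_sub, mul_one, sub_eq_zero] at h5
  have h7 : C = p * C := by
    have := congrArg conjTranspose h6
    rwa [conjTranspose_mul, conjTranspose_conjTranspose, hpH] at this
  have h8 : C * Cᴴ = (star ψ.ofLp ⬝ᵥ (C * Cᴴ) *ᵥ ψ.ofLp) • p := by
    have : C * Cᴴ = p * (C * Cᴴ) * p := by
      nth_rw 1 [h6, h7]; simp only [mul_assoc]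
    nth_rw 1 [this]
    rw [hp, proj, vecMulVec_mul, vecMulVec_mul_vecMulVec, vecMulVec_smul, ← dotProduct_mulVec]
  have h9 := congrArg trace h8
  rw [trace_smul, hp, trace_proj, hψ] at h9
  rw [h9]
  nth_rw 1 [h8]
  simp [hp]

end Proj

/-! ### Pseudo-inverses and partial isometries. -/

section Factorization

variable {a b c : Type*} [Fintype a] [Fintype b] [Fintype c] [DecidableEq b]

/-- The Moore-Penrose inverse of a Hermitian matrix. -/
theorem exists_pseudoInverse {G : Matrix b b ℂ} (hG : G.IsHermitian) :
    ∃ H : Matrix b b ℂ, Hᴴ = H ∧ H * G = G * H ∧ G * H * G = G ∧ H * G * H = H := by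
  have hGs : IsSelfAdjoint G := hG
  have hc : ∀ f : ℝ → ℝ, ContinuousOn f (spectrum ℝ G) := fun f =>
    (Matrix.finite_real_spectrum (A := G)).continuousOn f
  -- The convention 0⁻¹ = 0 makes this the Moore-Penrose inverse.
  refine ⟨cfc (fun x : ℝ => x⁻¹) G, (cfc_predicate (fun x : ℝ => x⁻¹) G : IsSelfAdjoint _),
    ?_, ?_, ?_⟩
  · have := (cfc_commute_cfc (fun x : ℝ => x⁻¹) (fun x => x) G).eq
    rwa [cfc_id' ℝ G] at this
  · conv_rhs => rw [← cfc_id' ℝ G]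
    have e : G * cfc (fun x : ℝ => x⁻¹) G * G = cfc (fun x : ℝ => x * x⁻¹ * x) G := by
      rw [cfc_mul _ _ G (hc _) (hc _), cfc_mul _ _ G (hc _) (hc _), cfc_id' ℝ G]
    rw [e]
    exact cfc_congr fun x _ => mul_inv_mul_cancel x
  · have e : cfc (fun x : ℝ => x⁻¹) G * G * cfc (fun x : ℝ => x⁻¹) G =
        cfc (fun x : ℝ => x⁻¹ * x * x⁻¹) G := by
      rw [cfc_mul _ _ G (hc _) (hc _), cfc_mul _ _ G (hc _) (hc _), cfc_id' ℝ G]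
    rw [e]
    refine cfc_congr fun x _ => ?_
    simpa using mul_inv_mul_cancel x⁻¹

/-- Two matrices with the same Gram matrix differ by a partial isometry. -/
theorem exists_partialIsometry {A : Matrix a b ℂ} {B : Matrix c b ℂ} (h : Aᴴ * A = Bᴴ * B) :
    ∃ W : Matrix c a ℂ, W * A = B ∧ Wᴴ * B = A ∧ W * Wᴴ * W = W := by
  set G := Aᴴ * A with hG
  obtain ⟨H, hHs, -, hGHG, hHGH⟩ := exists_pseudoInverse (posSemidef_conjTranspose_mul_self A).1
  rw [← hG] at hGHG hHGH
  -- HG is the projection onto the support of the common Gram matrix, which both A and B absorb on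
  -- the right.
  have keyA : A * (H * G) = A := by
    have : A * (H * G - 1) = 0 := by
      rw [← conjTranspose_mul_self_mul_eq_zero, ← hG, Matrix.mul_sub, ← Matrix.mul_assoc, hGHG,
        Matrix.mul_one, sub_self]
    rwa [Matrix.mul_sub, Matrix.mul_one, sub_eq_zero] at this
  have keyB : B * (H * G) = B := by
    have : B * (H * G - 1) = 0 := by
      rw [← conjTranspose_mul_self_mul_eq_zero, ← h, Matrix.mul_sub, ← Matrix.mul_assoc, hGHG,
        Matrix.mul_one, sub_self]
    rwa [Matrix.mul_sub, Matrix.mul_one, sub_eq_zero] at this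
  refine ⟨B * H * Aᴴ, ?_, ?_, ?_⟩
  · rw [Matrix.mul_assoc, ← hG, Matrix.mul_assoc, keyB]
  · rw [conjTranspose_mul, conjTranspose_mul, conjTranspose_conjTranspose, hHs, Matrix.mul_assoc,
      Matrix.mul_assoc, ← h, keyA]
  · rw [conjTranspose_mul, conjTranspose_mul, conjTranspose_conjTranspose, hHs]
    calc B * H * Aᴴ * (A * (H * Bᴴ)) * (B * H * Aᴴ)
        = B * (H * (Aᴴ * A) * H) * (Bᴴ * B) * H * Aᴴ := by simp only [Matrix.mul_assoc]
      _ = B * (H * G * H) * Aᴴ := by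
          rw [← hG, ← h, hHGH]; simp only [Matrix.mul_assoc]
          rw [← Matrix.mul_assoc G, ← Matrix.mul_assoc H, ← Matrix.mul_assoc H, hHGH]
      _ = B * H * Aᴴ := by rw [hHGH]

end Factorization

/-! ### Channels in Stinespring form, and contractivity. -/

section CompletelyPositive

variable {m n κ : Type*} [Fintype m] [DecidableEq m] [Fintype n] [DecidableEq n] [Fintype κ]

theorem cstarMatrix_gram_nonneg {k : ℕ} (V : Fin k → Matrix κ m ℂ) :
    0 ≤ (CStarMatrix.ofMatrix (Matrix.of fun i j => (V i)ᴴ * V j) :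
      CStarMatrix (Fin k) (Fin k) (Matrix m m ℂ)) := by
  rcases isEmpty_or_nonempty (Fin k) with hk | ⟨⟨i₀⟩⟩
  · exact le_of_eq (CStarMatrix.ext fun i => hk.elim i)
  rcases isEmpty_or_nonempty m with hm | ⟨⟨x₀⟩⟩
  · exact le_of_eq (CStarMatrix.ext fun i j => Matrix.ext fun x => hm.elim x)
  -- The V j are rectangular, while blocks must be m × m. Row r of every V j is therefore placed in
  -- row x₀ of block row i₀, and the Gram matrix is the sum over r.
  let Z : κ → CStarMatrix (Fin k) (Fin k) (Matrix m m ℂ) := fun r =>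
    CStarMatrix.ofMatrix (Matrix.of fun i j =>
      if i = i₀ then Matrix.of fun x y => if x = x₀ then V j r y else 0 else 0)
  have h : (CStarMatrix.ofMatrix (Matrix.of fun i j => (V i)ᴴ * V j) :
      CStarMatrix (Fin k) (Fin k) (Matrix m m ℂ)) = ∑ r, star (Z r) * Z r := by
    have hsum : ∀ i j, (∑ r, star (Z r) * Z r) i j = ∑ r, (star (Z r) * Z r) i j := fun i j =>
      Matrix.sum_apply i j Finset.univ fun r => star (Z r) * Z r
    refine CStarMatrix.ext fun i j => ?_
    rw [hsum]
    ext x y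
    rw [Matrix.sum_apply]
    simp only [CStarMatrix.ofMatrix_apply, of_apply, mul_apply, conjTranspose_apply]
    refine Finset.sum_congr rfl fun r _ => ?_
    rw [CStarMatrix.mul_apply, Matrix.sum_apply, Finset.sum_eq_single i₀]
    · rw [mul_apply, Finset.sum_eq_single x₀]
      · simp [Z, CStarMatrix.star_apply]
      · intro b _ hb
        simp [Z, hb]
      · simp
    · intro b _ hb
      simp [Z, hb]
    · simp
  rw [h]
  exact Finset.sum_nonneg fun r _ => star_mul_self_nonneg _

/-- Conjugation followed by a partial trace, as a linear map. -/
noncomputable def stinespringLinear (W : Matrix (m × κ) n ℂ) : Matrix n n ℂ →ₗ[ℂ] Matrix m m ℂ where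
  toFun X := trAux (W * X * Wᴴ)
  map_add' X Y := by
    ext i j
    simp [trAux, Matrix.mul_add, Matrix.add_mul, Finset.sum_add_distrib]
  map_smul' c X := by
    ext i j
    simp [trAux, Finset.mul_sum]

omit [Fintype m] [DecidableEq m] [DecidableEq n] in
theorem trAux_conj (W : Matrix (m × κ) n ℂ) (X : Matrix n n ℂ) :
    trAux (W * X * Wᴴ) =
      ∑ s, W.submatrix (fun i => (i, s)) id * X * (W.submatrix (fun i => (i, s)) id)ᴴ := by
  ext i j
  rw [Matrix.sum_apply]
  rfl

omit [DecidableEq n] in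
-- The image is again a Gram matrix, of the blocks N l j U_s† stacked over s and l, where U_s are
-- the Kraus operators cut out of W.
theorem stinespringLinear_map_star_mul_self_nonneg (W : Matrix (m × κ) n ℂ) {k : ℕ}
    (N : CStarMatrix (Fin k) (Fin k) (Matrix n n ℂ)) :
    0 ≤ (star N * N).map (stinespringLinear W) := by
  let V : Fin k → Matrix ((κ × Fin k) × n) m ℂ := fun j => Matrix.of fun p x =>
    (N p.1.2 j * (W.submatrix (fun i => (i, p.1.1)) id)ᴴ) p.2 x
  convert cstarMatrix_gram_nonneg V using 1
  refine CStarMatrix.ext fun i j => ?_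
  have h1 : (star N * N) i j = ∑ l, (N l i)ᴴ * N l j := by
    rw [CStarMatrix.mul_apply]; rfl
  rw [CStarMatrix.map_apply]
  change trAux (W * (star N * N) i j * Wᴴ) = (V i)ᴴ * V j
  rw [trAux_conj, h1]
  ext x y
  rw [Matrix.sum_apply, mul_apply, Fintype.sum_prod_type, Fintype.sum_prod_type]
  refine Finset.sum_congr rfl fun s _ => ?_
  rw [Matrix.mul_sum, Matrix.sum_mul, Matrix.sum_apply]
  refine Finset.sum_congr rfl fun l _ => ?_
  set U := W.submatrix (fun i => (i, s)) id with hU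
  have h2 : U * ((N l i)ᴴ * N l j) * Uᴴ = (N l i * Uᴴ)ᴴ * (N l j * Uᴴ) := by
    rw [conjTranspose_mul, conjTranspose_conjTranspose]
    simp only [Matrix.mul_assoc]
  rw [h2, mul_apply]
  rfl

/-- The completely positive map `X ↦ tr_κ (W X W†)`. -/
noncomputable def stinespring (W : Matrix (m × κ) n ℂ) : Matrix n n ℂ →CP Matrix m m ℂ where
  toLinearMap := stinespringLinear W
  map_cstarMatrix_nonneg' k M hM := by
    rw [StarOrderedRing.nonneg_iff] at hM
    induction hM using AddSubmonoid.closure_induction with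
    | mem x hx =>
      obtain ⟨N, rfl⟩ := hx
      exact stinespringLinear_map_star_mul_self_nonneg W N
    | zero =>
      exact le_of_eq (CStarMatrix.ext fun i j => (map_zero (stinespringLinear W)).symm)
    | add x y _ _ hx hy =>
      have h : (x + y).map (stinespringLinear W) =
          x.map (stinespringLinear W) + y.map (stinespringLinear W) :=
        CStarMatrix.ext fun i j => map_add (stinespringLinear W) (x i j) (y i j)
      exact (add_nonneg hx hy).trans_eq h.symm

theorem stinespring_apply (W : Matrix (m × κ) n ℂ) (X : Matrix n n ℂ) :
    stinespring W X = trAux (W * X * Wᴴ) := rfl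

omit [DecidableEq m] in
theorem trace_trAux (X : Matrix (m × κ) (m × κ) ℂ) : (trAux X).trace = X.trace := by
  simp only [trace, trAux, diag_apply, of_apply, Fintype.sum_prod_type]

omit [DecidableEq m] in
theorem trace_stinespring {W : Matrix (m × κ) n ℂ} (hW : Wᴴ * W = 1) (X : Matrix n n ℂ) :
    (trAux (W * X * Wᴴ)).trace = X.trace := by
  rw [trace_trAux, trace_mul_comm, ← Matrix.mul_assoc, hW, Matrix.one_mul]

omit [Fintype m] [DecidableEq m] in
theorem trAux_posSemidef {X : Matrix (m × κ) (m × κ) ℂ} (hX : X.PosSemidef) :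
    (trAux X).PosSemidef := by
  have : trAux X = ∑ s, X.submatrix (fun i => (i, s)) fun i => (i, s) := by
    ext i j
    rw [Matrix.sum_apply]
    rfl
  rw [this]
  exact posSemidef_sum _ fun s _ => hX.submatrix _

/-- The partial trace as a linear map. -/
noncomputable def trAuxLinear : Matrix (m × κ) (m × κ) ℂ →ₗ[ℂ] Matrix m m ℂ where
  toFun := trAux
  map_add' X Y := by ext; simp [trAux, Finset.sum_add_distrib]
  map_smul' c X := by ext; simp [trAux, Finset.mul_sum]

theorem traceDist_trAux_le [DecidableEq κ] {X Y : Matrix (m × κ) (m × κ) ℂ}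
    (h : (X - Y).IsHermitian) : traceDist (trAux X) (trAux Y) ≤ traceDist X Y :=
  traceDist_map_le trAuxLinear (fun _ => trAux_posSemidef) trace_trAux h

theorem map_posSemidef (Λ : Matrix n n ℂ →CP Matrix m m ℂ) {X : Matrix n n ℂ}
    (hX : X.PosSemidef) : (Λ X).PosSemidef :=
  nonneg_iff_posSemidef.1 (map_nonneg Λ hX.nonneg)

theorem traceDist_channel_le {Λ : Matrix n n ℂ →CP Matrix m m ℂ} (hΛ : IsTracePreserving Λ)
    {X Y : Matrix n n ℂ} (h : (X - Y).IsHermitian) : traceDist (Λ X) (Λ Y) ≤ traceDist X Y :=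
  traceDist_map_le Λ.toLinearMap (fun _ => map_posSemidef Λ) hΛ h

theorem traceDist_conj_le {W : Matrix m n ℂ} (hW : Wᴴ * W = 1) {X Y : Matrix n n ℂ}
    (h : (X - Y).IsHermitian) : traceDist (W * X * Wᴴ) (W * Y * Wᴴ) ≤ traceDist X Y := by
  let f : Matrix n n ℂ →ₗ[ℂ] Matrix m m ℂ :=
    { toFun := fun X => W * X * Wᴴ
      map_add' := fun X Y => by simp [Matrix.mul_add, Matrix.add_mul]
      map_smul' := fun c X => by simp }
  refine traceDist_map_le f (fun X hX => hX.mul_mul_conjTranspose_same W) (fun X => ?_) h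
  change (W * X * Wᴴ).trace = _
  rw [trace_mul_comm, ← Matrix.mul_assoc, hW, Matrix.one_mul]

end CompletelyPositive

/-! ### Principal angles and the worst-case distance. -/

open Module in
/-- The largest singular value bounds a linear map. -/
theorem norm_sq_le_singularValues_zero {E F : Type*} [NormedAddCommGroup E]
    [InnerProductSpace ℂ E] [FiniteDimensional ℂ E] [NormedAddCommGroup F]
    [InnerProductSpace ℂ F] [FiniteDimensional ℂ F] (T : E →ₗ[ℂ] F) (u : E) :
    ‖T u‖ ^ 2 ≤ T.singularValues 0 ^ 2 * ‖u‖ ^ 2 := by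
  set b := T.isSymmetric_adjoint_comp_self.eigenvectorBasis rfl with hb
  have h1 : inner ℂ u ((LinearMap.adjoint T ∘ₗ T) u) = ((‖T u‖ ^ 2 : ℝ) : ℂ) := by
    rw [LinearMap.comp_apply, LinearMap.adjoint_inner_right, inner_self_eq_norm_sq_to_K]
    norm_cast
  have h2 : ((‖T u‖ ^ 2 : ℝ) : ℂ) =
      ((∑ i : Fin (finrank ℂ E), T.singularValues i ^ 2 * ‖inner ℂ (b i) u‖ ^ 2 : ℝ) : ℂ) := by
    rw [← h1, ← b.sum_inner_mul_inner, Complex.ofReal_sum]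
    refine Finset.sum_congr rfl fun i _ => ?_
    have h3 : inner ℂ (b i) ((LinearMap.adjoint T ∘ₗ T) u) =
        ((T.singularValues i ^ 2 : ℝ) : ℂ) * inner ℂ (b i) u := by
      rw [← T.isSymmetric_adjoint_comp_self (b i) u, hb,
        T.isSymmetric_adjoint_comp_self.apply_eigenvectorBasis rfl i, inner_smul_left,
        T.sq_singularValues_fin rfl i]
      simp
    rw [h3, ← inner_conj_symm u (b i), mul_left_comm, Complex.conj_mul']
    push_cast
    ring
  rw [Complex.ofReal_inj] at h2
  rw [h2, ← b.sum_sq_norm_inner_right u, Finset.mul_sum]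
  refine Finset.sum_le_sum fun i _ => mul_le_mul_of_nonneg_right ?_ (sq_nonneg _)
  exact pow_le_pow_left₀ (T.singularValues_nonneg _) (T.singularValues_antitone (Nat.zero_le _)) 2

open Module in
theorem exists_norm_eq_singularValues_zero {E F : Type*} [NormedAddCommGroup E]
    [InnerProductSpace ℂ E] [FiniteDimensional ℂ E] [NormedAddCommGroup F]
    [InnerProductSpace ℂ F] [FiniteDimensional ℂ F] (T : E →ₗ[ℂ] F) [Nontrivial E] :
    ∃ u : E, ‖u‖ = 1 ∧ ‖T u‖ = T.singularValues 0 := by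
  have h0 : 0 < finrank ℂ E := finrank_pos
  set b := T.isSymmetric_adjoint_comp_self.eigenvectorBasis rfl with hb
  refine ⟨b ⟨0, h0⟩, b.norm_eq_one _, ?_⟩
  have h1 : ((‖T (b ⟨0, h0⟩)‖ ^ 2 : ℝ) : ℂ) = ((T.singularValues 0 ^ 2 : ℝ) : ℂ) := by
    have h : ((‖T (b ⟨0, h0⟩)‖ ^ 2 : ℝ) : ℂ) =
        inner ℂ (b ⟨0, h0⟩) ((LinearMap.adjoint T ∘ₗ T) (b ⟨0, h0⟩)) := by
      rw [LinearMap.comp_apply, LinearMap.adjoint_inner_right, inner_self_eq_norm_sq_to_K]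
      norm_cast
    rw [h, hb, T.isSymmetric_adjoint_comp_self.apply_eigenvectorBasis rfl, inner_smul_right,
      ← hb, inner_self_eq_norm_sq_to_K, b.norm_eq_one, T.sq_singularValues_of_lt rfl h0]
    simp
  rw [Complex.ofReal_inj] at h1
  exact (pow_left_inj₀ (norm_nonneg _) (T.singularValues_nonneg _) two_ne_zero).1 h1

/-- `c` is the largest overlap of unit vectors taken from `U` and `V`. -/
structure IsMaxOverlap {E : Type*} [NormedAddCommGroup E] [InnerProductSpace ℂ E]
    (U V : Submodule ℂ E) (c : ℝ) : Prop where
  nonneg : 0 ≤ c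
  norm_inner_le : ∀ u ∈ U, ∀ v ∈ V, ‖inner ℂ u v‖ ≤ c * (‖u‖ * ‖v‖)
  exists_eq : ∃ u ∈ U, ∃ v ∈ V, ‖u‖ = 1 ∧ ‖v‖ = 1 ∧ ‖inner ℂ u v‖ = c

theorem IsMaxOverlap.le_one {E : Type*} [NormedAddCommGroup E] [InnerProductSpace ℂ E]
    {U V : Submodule ℂ E} {c : ℝ} (h : IsMaxOverlap U V c) : c ≤ 1 := by
  obtain ⟨u, -, v, -, hu, hv, rfl⟩ := h.exists_eq
  simpa [hu, hv] using norm_inner_le_norm (𝕜 := ℂ) u v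

/-- For u in U, v in V one has ⟨u, v⟩ = ⟨Tu, v⟩, so the best v is Tu normalized and the best u is a
top singular vector. -/
theorem exists_isMaxOverlap {E : Type*} [NormedAddCommGroup E] [InnerProductSpace ℂ E]
    [FiniteDimensional ℂ E] {U V : Submodule ℂ E} (hU : U ≠ ⊥) (hV : V ≠ ⊥) :
    ∃ c, IsMaxOverlap U V c ∧ canonicalAngle U V 0 = Real.arccos c := by
  set T : U →ₗ[ℂ] V := V.orthogonalProjectionOnto.toLinearMap ∘ₗ U.subtype with hT
  have hTi : ∀ (u : U) (v : V), inner ℂ (T u) v = inner ℂ (u : E) (v : E) := fun u v =>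
    Submodule.inner_orthogonalProjectionOnto_eq_of_mem_right v (u : E)
  have hTn : ∀ u : U, ‖T u‖ ≤ T.singularValues 0 * ‖u‖ := fun u =>
    le_of_sq_le_sq (by rw [mul_pow]; exact norm_sq_le_singularValues_zero T u)
      (mul_nonneg (T.singularValues_nonneg 0) (norm_nonneg _))
  have : Nontrivial U := Submodule.nontrivial_iff_ne_bot.2 hU
  refine ⟨T.singularValues 0, ⟨T.singularValues_nonneg 0, fun u hu v hv => ?_, ?_⟩, rfl⟩
  · rw [← hTi ⟨u, hu⟩ ⟨v, hv⟩, ← mul_assoc]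
    exact (norm_inner_le_norm _ _).trans
      (mul_le_mul_of_nonneg_right (hTn ⟨u, hu⟩) (norm_nonneg _))
  · obtain ⟨u, hu, hu'⟩ := exists_norm_eq_singularValues_zero T
    -- If Tu = 0 the maximum is 0, and any unit vector of V serves.
    rcases eq_or_ne (T u) 0 with h | h
    · obtain ⟨v, hv, hv0⟩ := (Submodule.ne_bot_iff V).1 hV
      refine ⟨u, u.2, ((‖v‖⁻¹ : ℝ) : ℂ) • v, V.smul_mem _ hv, hu, ?_, ?_⟩
      · rw [norm_smul, Complex.norm_real, norm_inv, norm_norm,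
          inv_mul_cancel₀ (norm_ne_zero_iff.2 hv0)]
      · rw [inner_smul_right, ← hTi u ⟨v, hv⟩, h, ← hu', h]
        simp
    · refine ⟨u, u.2, ((‖T u‖⁻¹ : ℝ) : ℂ) • (T u : E), V.smul_mem _ (T u).2, hu, ?_, ?_⟩
      · rw [norm_smul, Complex.norm_real, norm_inv, norm_norm, Submodule.coe_norm,
          inv_mul_cancel₀ (by simpa using h)]
      · rw [inner_smul_right, ← hTi u (T u), inner_self_eq_norm_sq_to_K, ← hu']
        have : ‖T u‖ ≠ 0 := norm_ne_zero_iff.2 h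
        rw [norm_mul, Complex.norm_real]
        simp
        field_simp

section WorstCase

variable {n : Type*} [Fintype n] [DecidableEq n]

theorem rangeOf_ne_bot {ρ : Matrix n n ℂ} (hρ : IsState ρ) : rangeOf ρ ≠ ⊥ := by
  intro h
  have h1 : ρ = 0 := by
    rw [rangeOf, LinearMap.range_eq_bot] at h
    simpa using h
  have h2 := hρ.2
  rw [h1, Matrix.trace_zero] at h2
  exact zero_ne_one h2

theorem isLeast_pureDistances {ρ ρ' : Matrix n n ℂ} {c : ℝ}
    (hc : IsMaxOverlap (rangeOf ρ) (rangeOf ρ') c) : IsLeast (pureDistances ρ ρ') √(1 - c ^ 2) := by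
  constructor
  · obtain ⟨u, hu, v, hv, hu1, hv1, rfl⟩ := hc.exists_eq
    exact ⟨u, hu, v, hv, hu1, hv1, (traceDist_proj hu1 hv1).symm⟩
  · rintro t ⟨u, hu, v, hv, hu1, hv1, rfl⟩
    rw [traceDist_proj hu1 hv1]
    have := hc.norm_inner_le u hu v hv
    rw [hu1, hv1, mul_one, mul_one] at this
    gcongr

theorem worstCaseDist_eq {ρ ρ' : Matrix n n ℂ} {c : ℝ}
    (hc : IsMaxOverlap (rangeOf ρ) (rangeOf ρ') c) : worstCaseDist ρ ρ' = √(1 - c ^ 2) :=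
  (isLeast_pureDistances hc).csInf_eq

end WorstCase

/-! ### Product vectors and block stacking. -/

section Tensor

variable {m n k κ κ' : Type*}

/-- The operator `|Ψ⟩ ⊗ N`. -/
def ketTensor (Ψ : EuclideanSpace ℂ m) (N : Matrix κ n ℂ) : Matrix (m × κ) n ℂ :=
  Matrix.of fun p j => Ψ p.1 * N p.2 j

theorem ketTensor_mul [Fintype n] (Ψ : EuclideanSpace ℂ m) (N : Matrix κ n ℂ) (X : Matrix n k ℂ) :
    ketTensor Ψ N * X = ketTensor Ψ (N * X) := by
  ext p j
  simp [ketTensor, mul_apply, Finset.mul_sum, mul_assoc]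

theorem ketTensor_mul_conjTranspose [Fintype n] (Ψ : EuclideanSpace ℂ m) (N N' : Matrix κ n ℂ) :
    ketTensor Ψ N * (ketTensor Ψ N')ᴴ = proj Ψ ⊗ₖ (N * N'ᴴ) := by
  ext p q
  simp only [ketTensor, mul_apply, of_apply, conjTranspose_apply, kroneckerMap_apply, proj,
    vecMulVec_apply, Finset.mul_sum, star_mul', Pi.star_apply]
  exact Finset.sum_congr rfl fun _ _ => by ring

theorem conjTranspose_ketTensor_mul [Fintype m] [Fintype κ] (Ψ Ψ' : EuclideanSpace ℂ m)
    (N : Matrix κ n ℂ) (N' : Matrix κ k ℂ) :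
    (ketTensor Ψ N)ᴴ * ketTensor Ψ' N' = (inner ℂ Ψ Ψ' : ℂ) • (Nᴴ * N') := by
  ext i j
  rw [EuclideanSpace.inner_eq_star_dotProduct]
  simp only [ketTensor, mul_apply, of_apply, conjTranspose_apply, star_mul', Matrix.smul_apply,
    smul_eq_mul, dotProduct, Pi.star_apply, Finset.sum_mul_sum, Fintype.sum_prod_type]
  exact Finset.sum_congr rfl fun _ _ => Finset.sum_congr rfl fun _ _ => by ring

theorem trAux_kronecker [Fintype κ] (X : Matrix m m ℂ) (r : Matrix κ κ ℂ) :
    trAux (X ⊗ₖ r) = r.trace • X := by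
  ext i j
  simp [trAux, trace, ← Finset.mul_sum, mul_comm]

/-- Stacks two operators with a common first output factor along the second factor. -/
def stackAux (A : Matrix (m × κ) n ℂ) (B : Matrix (m × κ') n ℂ) : Matrix (m × (κ ⊕ κ')) n ℂ :=
  Matrix.of fun p j => Sum.elim (fun s => A (p.1, s) j) (fun s => B (p.1, s) j) p.2

theorem stackAux_mul [Fintype n] (A : Matrix (m × κ) n ℂ) (B : Matrix (m × κ') n ℂ)
    (X : Matrix n k ℂ) : stackAux A B * X = stackAux (A * X) (B * X) := by
  ext ⟨p, s⟩ j
  rcases s with s | s <;> simp [stackAux, mul_apply]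

theorem stackAux_ketTensor (Ψ : EuclideanSpace ℂ m) (A : Matrix κ n ℂ) (B : Matrix κ' n ℂ) :
    stackAux (ketTensor Ψ A) (ketTensor Ψ B) = ketTensor Ψ (fromRows A B) := by
  ext ⟨p, s⟩ j
  rcases s with s | s <;> simp [stackAux, ketTensor]

theorem conjTranspose_stackAux_mul_self [Fintype m] [Fintype κ] [Fintype κ']
    (A : Matrix (m × κ) n ℂ) (B : Matrix (m × κ') n ℂ) :
    (stackAux A B)ᴴ * stackAux A B = Aᴴ * A + Bᴴ * B := by
  ext i j
  simp only [stackAux, mul_apply, of_apply, conjTranspose_apply, Matrix.add_apply,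
    Fintype.sum_prod_type, Fintype.sum_sum_type, Sum.elim_inl, Sum.elim_inr,
    Finset.sum_add_distrib]

end Tensor

/-! ### The dilation of a pair of projections. -/

section Dilation

variable {m n : Type*} [Fintype m] [Fintype n] [DecidableEq n]

/-- Two projections whose product is `c` times a contraction can be mapped isometrically onto
`Ψ ⊗ ·` and `Ψ' ⊗ ·` when the unit vectors `Ψ` and `Ψ'` have overlap `c`. -/
theorem exists_dilation_of_contraction {P Q C : Matrix n n ℂ} {c : ℝ} (hP : Pᴴ = P)
    (hPP : P * P = P) (hQ : Qᴴ = Q) (hQQ : Q * Q = Q) (hC : (c : ℂ) • C = Q * P)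
    (hC1 : (1 - Cᴴ * C).PosSemidef) {Ψ Ψ' : EuclideanSpace ℂ m} (hΨ : ‖Ψ‖ = 1) (hΨ' : ‖Ψ'‖ = 1)
    (hi : inner ℂ Ψ Ψ' = (c : ℂ)) :
    ∃ (W : Matrix (m × ((n ⊕ n) ⊕ n)) n ℂ) (L L' : Matrix ((n ⊕ n) ⊕ n) n ℂ),
      Wᴴ * W = 1 ∧ W * P = ketTensor Ψ L ∧ W * Q = ketTensor Ψ' L' := by
  obtain ⟨K, hK⟩ := exists_eq_mul_conjTranspose hC1
  -- The block K†P completes CP to Gram matrix P, since C†C + KK† = 1. The zero block in L₂ leaves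
  -- the cross term c L₁†L₂ = PQ.
  set L₁ : Matrix (n ⊕ n) n ℂ := fromRows (C * P) (Kᴴ * P) with hL₁
  set L₂ : Matrix (n ⊕ n) n ℂ := fromRows Q 0 with hL₂
  have h11 : L₁ᴴ * L₁ = P := by
    rw [hL₁, conjTranspose_fromRows_eq_fromCols_conjTranspose, fromCols_mul_fromRows,
      conjTranspose_mul, conjTranspose_mul, conjTranspose_conjTranspose, hP]
    calc P * Cᴴ * (C * P) + P * K * (Kᴴ * P) = P * (Cᴴ * C + K * Kᴴ) * P := by noncomm_ring
      _ = P := by rw [← hK, add_sub_cancel, mul_one, hPP]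
  have h22 : L₂ᴴ * L₂ = Q := by
    rw [hL₂, conjTranspose_fromRows_eq_fromCols_conjTranspose, fromCols_mul_fromRows, hQ, hQQ]
    simp
  have h12 : (c : ℂ) • (L₁ᴴ * L₂) = P * Q := by
    rw [hL₁, hL₂, conjTranspose_fromRows_eq_fromCols_conjTranspose, fromCols_mul_fromRows,
      mul_zero, add_zero, conjTranspose_mul, hP, ← smul_mul_assoc, ← mul_smul_comm]
    have : (c : ℂ) • Cᴴ = P * Q := by
      have := congrArg conjTranspose hC
      rwa [conjTranspose_smul, conjTranspose_mul, hP, hQ, Complex.star_def,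
        Complex.conj_ofReal] at this
    rw [this, ← mul_assoc, hPP, mul_assoc, hQQ]
  have h21 : (c : ℂ) • (L₂ᴴ * L₁) = Q * P := by
    have := congrArg conjTranspose h12
    rwa [conjTranspose_smul, conjTranspose_mul, conjTranspose_mul, conjTranspose_conjTranspose,
      hP, hQ, Complex.star_def, Complex.conj_ofReal] at this
  have hi' : inner ℂ Ψ' Ψ = (c : ℂ) := by
    rw [← inner_conj_symm, hi, Complex.conj_ofReal]
  have hΨi : inner ℂ Ψ Ψ = (1 : ℂ) := by rw [inner_self_eq_norm_sq_to_K, hΨ]; simp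
  have hΨi' : inner ℂ Ψ' Ψ' = (1 : ℂ) := by rw [inner_self_eq_norm_sq_to_K, hΨ']; simp
  have hgram : (fromCols P Q)ᴴ * fromCols P Q =
      (fromCols (ketTensor Ψ L₁) (ketTensor Ψ' L₂))ᴴ *
        fromCols (ketTensor Ψ L₁) (ketTensor Ψ' L₂) := by
    rw [conjTranspose_fromCols_eq_fromRows_conjTranspose,
      conjTranspose_fromCols_eq_fromRows_conjTranspose, fromRows_mul_fromCols,
      fromRows_mul_fromCols]
    simp only [conjTranspose_ketTensor_mul, hi, hi', hΨi, hΨi', h11, h22, h12, h21, hP, hQ, hPP,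
      hQQ, one_smul]
  obtain ⟨W₀, hW₁, hW₂, hW₃⟩ := exists_partialIsometry hgram
  rw [mul_fromCols] at hW₁
  replace hW₁ := fromCols_inj hW₁
  have hR0 : (1 - W₀ᴴ * W₀) * fromCols P Q = 0 := by
    rw [Matrix.sub_mul, Matrix.one_mul, Matrix.mul_assoc, mul_fromCols, hW₁.1, hW₁.2, hW₂, sub_self]
  rw [mul_fromCols, ← fromCols_zero] at hR0
  replace hR0 := fromCols_inj hR0
  have hRR : (1 - W₀ᴴ * W₀)ᴴ * (1 - W₀ᴴ * W₀) = 1 - W₀ᴴ * W₀ := by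
    have h : W₀ᴴ * W₀ * (W₀ᴴ * W₀) = W₀ᴴ * W₀ := by
      rw [Matrix.mul_assoc, ← Matrix.mul_assoc W₀, hW₃]
    rw [conjTranspose_sub, conjTranspose_mul, conjTranspose_conjTranspose, conjTranspose_one,
      mul_sub, mul_one, sub_mul, one_mul, h, sub_self, sub_zero]
  -- W₀ is only a partial isometry; its kernel goes to a fresh auxiliary block. The added part
  -- vanishes on the ranges of P and Q.
  refine ⟨stackAux W₀ (ketTensor Ψ (1 - W₀ᴴ * W₀)), fromRows L₁ 0, fromRows L₂ 0, ?_, ?_, ?_⟩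
  · rw [conjTranspose_stackAux_mul_self, conjTranspose_ketTensor_mul, hΨi, one_smul, hRR,
      add_sub_cancel]
  · rw [stackAux_mul, hW₁.1, ketTensor_mul, hR0.1, stackAux_ketTensor]
  · have h0 : ketTensor Ψ (0 : Matrix n n ℂ) = ketTensor Ψ' 0 := by ext; simp [ketTensor]
    rw [stackAux_mul, hW₁.2, ketTensor_mul, hR0.2, h0, stackAux_ketTensor]

end Dilation

/-! ### Supports and the contraction QP / c. -/

section Support

variable {n : Type*} [Fintype n] [DecidableEq n]

/-- The support projection of a Hermitian matrix. -/
theorem exists_support {ρ : Matrix n n ℂ} (hρ : ρ.IsHermitian) :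
    ∃ P : Matrix n n ℂ, Pᴴ = P ∧ P * P = P ∧ P * ρ = ρ ∧
      ∀ x, toEuclideanLin P x ∈ rangeOf ρ := by
  obtain ⟨H, hH, hcomm, h1, h2⟩ := exists_pseudoInverse hρ
  refine ⟨ρ * H, ?_, ?_, h1, fun x => ⟨toEuclideanLin H x, ?_⟩⟩
  · rw [conjTranspose_mul, hH, hρ.eq, hcomm]
  · rw [← mul_assoc, h1]
  · simp [toLpLin_apply, mulVec_mulVec]

theorem norm_toEuclideanLin_sq {m : Type*} [Fintype m] (X : Matrix m n ℂ)
    (x : EuclideanSpace ℂ n) :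
    ((‖toEuclideanLin X x‖ ^ 2 : ℝ) : ℂ) = star x.ofLp ⬝ᵥ (Xᴴ * X) *ᵥ x.ofLp := by
  rw [← star_dotProduct_self, toLpLin_apply, ← mulVec_mulVec, dotProduct_mulVec _ Xᴴ,
    star_mulVec]

theorem posSemidef_one_sub_of_norm_le {m : Type*} [Fintype m] {X : Matrix m n ℂ}
    (h : ∀ x, ‖toEuclideanLin X x‖ ≤ ‖x‖) : (1 - Xᴴ * X).PosSemidef := by
  refine .of_dotProduct_mulVec_nonneg
    (isHermitian_one.sub (isHermitian_conjTranspose_mul_self X)) fun x => ?_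
  have h1 := norm_toEuclideanLin_sq X (WithLp.toLp 2 x)
  have h2 := star_dotProduct_self (WithLp.toLp 2 x)
  rw [sub_mulVec, dotProduct_sub, one_mulVec, ← h1, h2, ← Complex.ofReal_sub,
    Complex.zero_le_real, sub_nonneg]
  gcongr
  exact h _

theorem exists_contraction {P Q : Matrix n n ℂ} {U V : Submodule ℂ (EuclideanSpace ℂ n)} {c : ℝ}
    (hc : IsMaxOverlap U V c) (hP : Pᴴ = P) (hPP : P * P = P) (hQ : Qᴴ = Q) (hQQ : Q * Q = Q)
    (hPU : ∀ x, toEuclideanLin P x ∈ U) (hQV : ∀ x, toEuclideanLin Q x ∈ V) :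
    ∃ C : Matrix n n ℂ, (c : ℂ) • C = Q * P ∧ (1 - Cᴴ * C).PosSemidef := by
  have hPn : ∀ x, ‖toEuclideanLin P x‖ ≤ ‖x‖ := by
    intro x
    have h1 : ((‖toEuclideanLin P x‖ ^ 2 : ℝ) : ℂ) = inner ℂ x (toEuclideanLin P x) := by
      rw [norm_toEuclideanLin_sq, hP, hPP, EuclideanSpace.inner_eq_star_dotProduct,
        dotProduct_comm, toLpLin_apply]
    have h2 := norm_inner_le_norm (𝕜 := ℂ) x (toEuclideanLin P x)
    rw [← h1, Complex.norm_real, norm_pow, norm_norm] at h2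
    nlinarith [norm_nonneg x, norm_nonneg (toEuclideanLin P x)]
  have hQP : ∀ x, ‖toEuclideanLin (Q * P) x‖ ≤ c * ‖x‖ := by
    intro x
    have e : toEuclideanLin (Q * P) x = toEuclideanLin Q (toEuclideanLin P x) := by
      simp [toLpLin_apply, mulVec_mulVec]
    -- ‖QPx‖² = ⟨Px, QPx⟩ ≤ c ‖Px‖ ‖QPx‖, and one factor cancels.
    have h1 : ((‖toEuclideanLin (Q * P) x‖ ^ 2 : ℝ) : ℂ) =
        inner ℂ (toEuclideanLin P x) (toEuclideanLin Q (toEuclideanLin P x)) := by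
      rw [e, norm_toEuclideanLin_sq, hQ, hQQ, EuclideanSpace.inner_eq_star_dotProduct,
        dotProduct_comm, toLpLin_apply _ _ Q]
    have h2 := hc.norm_inner_le _ (hPU x) _ (hQV (toEuclideanLin P x))
    rw [← h1, Complex.norm_real, norm_pow, norm_norm, ← e] at h2
    have h3 : c * ‖toEuclideanLin P x‖ ≤ c * ‖x‖ := mul_le_mul_of_nonneg_left (hPn x) hc.nonneg
    by_contra! h4
    have h5 : 0 < ‖toEuclideanLin (Q * P) x‖ :=
      lt_of_le_of_lt (mul_nonneg hc.nonneg (norm_nonneg x)) h4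
    nlinarith
  rcases hc.nonneg.eq_or_lt with h0 | h0
  · refine ⟨0, ?_, by simpa using PosSemidef.one⟩
    have : toEuclideanLin (Q * P) = 0 := by
      ext1 x
      have := hQP x
      rw [← h0, zero_mul] at this
      simpa using this
    rw [smul_zero]
    exact (toEuclideanLin.map_eq_zero_iff.1 this).symm
  · refine ⟨((c⁻¹ : ℝ) : ℂ) • (Q * P), ?_, posSemidef_one_sub_of_norm_le fun x => ?_⟩
    · rw [smul_smul, ← Complex.ofReal_mul, mul_inv_cancel₀ h0.ne', Complex.ofReal_one, one_smul]
    · rw [map_smul, LinearMap.smul_apply, norm_smul, Complex.norm_real, norm_inv,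
        Real.norm_of_nonneg hc.nonneg]
      have := hQP x
      field_simp
      linarith

end Support

/-! ### Dilating and transforming a pair of states. -/

section StateDilation

variable {m n : Type*} [Fintype m] [DecidableEq m] [Fintype n] [DecidableEq n]

omit [DecidableEq m] in
-- Each state is unchanged by its support projection on both sides, so the action of W on that
-- projection determines the whole image.
theorem exists_dilation {ρ ρ' : Matrix n n ℂ} (hρ : IsState ρ) (hρ' : IsState ρ') {c : ℝ}
    (hc : IsMaxOverlap (rangeOf ρ) (rangeOf ρ') c) {Ψ Ψ' : EuclideanSpace ℂ m} (hΨ : ‖Ψ‖ = 1)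
    (hΨ' : ‖Ψ'‖ = 1) (hi : inner ℂ Ψ Ψ' = (c : ℂ)) :
    ∃ (W : Matrix (m × ((n ⊕ n) ⊕ n)) n ℂ) (r r' : Matrix ((n ⊕ n) ⊕ n) ((n ⊕ n) ⊕ n) ℂ),
      Wᴴ * W = 1 ∧ IsState r ∧ IsState r' ∧ W * ρ * Wᴴ = proj Ψ ⊗ₖ r ∧
        W * ρ' * Wᴴ = proj Ψ' ⊗ₖ r' := by
  obtain ⟨P, hP, hPP, hPρ, hPU⟩ := exists_support hρ.1.1
  obtain ⟨Q, hQ, hQQ, hQρ, hQV⟩ := exists_support hρ'.1.1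
  obtain ⟨C, hC, hC1⟩ := exists_contraction hc hP hPP hQ hQQ hPU hQV
  obtain ⟨W, L, L', hW, hWP, hWQ⟩ :=
    exists_dilation_of_contraction hP hPP hQ hQQ hC hC1 hΨ hΨ' hi
  have key : ∀ {σ R : Matrix n n ℂ} {N : Matrix ((n ⊕ n) ⊕ n) n ℂ} {Φ : EuclideanSpace ℂ m},
      IsState σ → R * σ = σ → ‖Φ‖ = 1 → W * R = ketTensor Φ N →
      IsState (N * σ * Nᴴ) ∧ W * σ * Wᴴ = proj Φ ⊗ₖ (N * σ * Nᴴ) := by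
    intro σ R N Φ hσ hR hΦ hN
    have hRσ : σ * Rᴴ = σ := by
      have := congrArg conjTranspose hR
      rwa [conjTranspose_mul, hσ.1.1] at this
    have h1 : W * σ * Wᴴ = proj Φ ⊗ₖ (N * σ * Nᴴ) := by
      calc W * σ * Wᴴ = W * (R * σ * Rᴴ) * Wᴴ := by rw [hR, hRσ]
        _ = W * R * σ * (W * R)ᴴ := by rw [conjTranspose_mul]; simp only [Matrix.mul_assoc]
        _ = _ := by rw [hN, ketTensor_mul, ketTensor_mul_conjTranspose]
    refine ⟨⟨hσ.1.mul_mul_conjTranspose_same N, ?_⟩, h1⟩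
    have h2 := congrArg trace h1
    rw [trace_mul_comm, ← Matrix.mul_assoc, hW, Matrix.one_mul, hσ.2, trace_kronecker, trace_proj,
      hΦ] at h2
    simpa using h2.symm
  obtain ⟨h1, h2⟩ := key hρ hPρ hΨ hWP
  obtain ⟨h3, h4⟩ := key hρ' hQρ hΨ' hWQ
  exact ⟨W, _, _, hW, h1, h3, h2, h4⟩

/-- Two states can be deterministically mapped to any two pure states whose overlap is the largest
overlap of unit vectors in their ranges. -/
theorem exists_channel {ρ ρ' : Matrix n n ℂ} (hρ : IsState ρ) (hρ' : IsState ρ') {c : ℝ}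
    (hc : IsMaxOverlap (rangeOf ρ) (rangeOf ρ') c) {Ψ Ψ' : EuclideanSpace ℂ m} (hΨ : ‖Ψ‖ = 1)
    (hΨ' : ‖Ψ'‖ = 1) (hi : inner ℂ Ψ Ψ' = (c : ℂ)) :
    ∃ Λ : Matrix n n ℂ →CP Matrix m m ℂ, IsTracePreserving Λ ∧ Λ ρ = proj Ψ ∧ Λ ρ' = proj Ψ' := by
  obtain ⟨W, r, r', hW, hr, hr', h, h'⟩ := exists_dilation hρ hρ' hc hΨ hΨ' hi
  refine ⟨stinespring W, fun X => ?_, ?_, ?_⟩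
  · rw [stinespring_apply, trace_stinespring hW]
  · rw [stinespring_apply, h, trAux_kronecker, hr.2, one_smul]
  · rw [stinespring_apply, h', trAux_kronecker, hr'.2, one_smul]

end StateDilation

/-! ### Uhlmann's theorem and the bound F ≤ c. -/

section Uhlmann

variable {n κ : Type*} [Fintype n] [DecidableEq n] [Fintype κ]

theorem conjTranspose_sqrt (A : Matrix n n ℂ) : (CFC.sqrt A)ᴴ = CFC.sqrt A :=
  (nonneg_iff_posSemidef.1 (CFC.sqrt_nonneg A)).1

omit [DecidableEq n] in
theorem re_trace_partialIsometry_le [DecidableEq κ] {a b : Type*} [Fintype a] [Fintype b]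
    {G : Matrix a κ ℂ} (hG : G * Gᴴ * G = G) (X : Matrix κ b ℂ) :
    ((G * X)ᴴ * (G * X)).trace.re ≤ (Xᴴ * X).trace.re := by
  have h : Xᴴ * X - (G * X)ᴴ * (G * X) = ((1 - Gᴴ * G) * X)ᴴ * ((1 - Gᴴ * G) * X) := by
    have h1 : (1 - Gᴴ * G)ᴴ * (1 - Gᴴ * G) = 1 - Gᴴ * G := by
      have h2 : Gᴴ * G * (Gᴴ * G) = Gᴴ * G := by
        rw [Matrix.mul_assoc, ← Matrix.mul_assoc G, hG]
      rw [conjTranspose_sub, conjTranspose_mul, conjTranspose_conjTranspose, conjTranspose_one,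
        mul_sub, mul_one, sub_mul, one_mul, h2, sub_self, sub_zero]
    rw [conjTranspose_mul, conjTranspose_mul, Matrix.mul_assoc Xᴴ (1 - Gᴴ * G)ᴴ,
      ← Matrix.mul_assoc (1 - Gᴴ * G)ᴴ, h1, Matrix.sub_mul, Matrix.one_mul, Matrix.mul_sub]
    simp only [Matrix.mul_assoc]
  have h3 := re_trace_conjTranspose_mul_self_nonneg ((1 - Gᴴ * G) * X)
  rw [← h, trace_sub, Complex.sub_re] at h3
  linarith

/-- The polar decomposition √ρ'√ρ = VR, whose positive factor R has trace F. -/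
theorem exists_polar_of_fidelity (ρ : Matrix n n ℂ) {ρ' : Matrix n n ℂ}
    (hρ' : ρ'.PosSemidef) :
    ∃ R V : Matrix n n ℂ, R.PosSemidef ∧ (fidelity ρ ρ' : ℂ) = R.trace ∧
      V * R = CFC.sqrt ρ' * CFC.sqrt ρ ∧ Vᴴ * (CFC.sqrt ρ' * CFC.sqrt ρ) = R ∧ V * Vᴴ * V = V := by
  set R := CFC.sqrt (CFC.sqrt ρ * ρ' * CFC.sqrt ρ) with hR
  have hR0 : R.PosSemidef := nonneg_iff_posSemidef.1 (CFC.sqrt_nonneg _)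
  have h1 : (CFC.sqrt ρ * ρ' * CFC.sqrt ρ).PosSemidef := by
    have := hρ'.mul_mul_conjTranspose_same (CFC.sqrt ρ)
    rwa [conjTranspose_sqrt] at this
  have h2 : Rᴴ * R = (CFC.sqrt ρ' * CFC.sqrt ρ)ᴴ * (CFC.sqrt ρ' * CFC.sqrt ρ) := by
    rw [hR0.1, hR, CFC.sqrt_mul_sqrt_self _ h1.nonneg, conjTranspose_mul, conjTranspose_sqrt,
      conjTranspose_sqrt]
    nth_rw 1 [← CFC.sqrt_mul_sqrt_self ρ' hρ'.nonneg]
    simp only [mul_assoc]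
  obtain ⟨V, hV⟩ := exists_partialIsometry h2
  refine ⟨R, V, hR0, ?_, hV⟩
  exact Complex.ext rfl (Complex.le_def.1 hR0.trace_nonneg).2

theorem fidelity_nonneg {ρ ρ' : Matrix n n ℂ} (hρ' : ρ'.PosSemidef) : 0 ≤ fidelity ρ ρ' := by
  obtain ⟨R, V, hR, h, -⟩ := exists_polar_of_fidelity ρ hρ'
  rw [← Complex.zero_le_real, h]
  exact hR.trace_nonneg

/-- The overlap of two purifications is bounded by the fidelity. -/
theorem norm_trace_le_fidelity {ρ ρ' : Matrix n n ℂ}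
    (hρ : ρ.PosSemidef) (hρ' : ρ'.PosSemidef) {M M' : Matrix n κ ℂ} (hM : M * Mᴴ = ρ)
    (hM' : M' * M'ᴴ = ρ') : ‖(M'ᴴ * M).trace‖ ≤ fidelity ρ ρ' := by
  obtain ⟨R, V, hR, hF, hVR, -, hV⟩ := exists_polar_of_fidelity ρ hρ'
  have key : ∀ {σ : Matrix n n ℂ} {N : Matrix n κ ℂ}, σ.PosSemidef → N * Nᴴ = σ →
      ∃ G : Matrix κ n ℂ, G * CFC.sqrt σ = Nᴴ ∧ G * Gᴴ * G = G := by
    intro σ N hσ hN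
    obtain ⟨G, h1, -, h3⟩ := exists_partialIsometry (A := CFC.sqrt σ) (B := Nᴴ) (by
      rw [conjTranspose_sqrt, CFC.sqrt_mul_sqrt_self σ hσ.nonneg, conjTranspose_conjTranspose, hN])
    exact ⟨G, h1, h3⟩
  obtain ⟨G, hG, hGG⟩ := key hρ hM
  obtain ⟨G', hG', hGG'⟩ := key hρ' hM'
  set T := CFC.sqrt R with hT
  have hTH : Tᴴ = T := conjTranspose_sqrt R
  have hTT : T * T = R := CFC.sqrt_mul_sqrt_self R hR.nonneg
  -- Splitting R = T² puts one T on each side. Partial isometries do not increase the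
  -- Hilbert-Schmidt norm, and ‖T‖² = tr R = F.
  have h1 : (M'ᴴ * M).trace = ((G * T)ᴴ * (G' * (V * T))).trace := by
    have hMG : M = CFC.sqrt ρ * Gᴴ := by
      have := congrArg conjTranspose hG
      rw [conjTranspose_mul, conjTranspose_conjTranspose, conjTranspose_sqrt] at this
      exact this.symm
    have h2 : M'ᴴ * M = G' * (V * T) * (G * T)ᴴ := by
      calc M'ᴴ * M = G' * (CFC.sqrt ρ' * CFC.sqrt ρ) * Gᴴ := by
            rw [← hG', hMG]; simp only [Matrix.mul_assoc]
        _ = _ := by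
            rw [← hVR, ← hTT, conjTranspose_mul, hTH]; simp only [Matrix.mul_assoc]
    rw [h2, trace_mul_comm]
  have hTr : (Tᴴ * T).trace.re = fidelity ρ ρ' := by
    rw [hTH, hTT, ← hF, Complex.ofReal_re]
  have h2 := norm_trace_conjTranspose_mul_le (G * T) (G' * (V * T))
  have h3 := re_trace_partialIsometry_le hGG T
  have h4 := re_trace_partialIsometry_le hGG' (V * T)
  have h5 := re_trace_partialIsometry_le hV T
  rw [h1]
  linarith

theorem exists_trace_eq_fidelity {ρ ρ' : Matrix n n ℂ}
    (hρ : ρ.PosSemidef) (hρ' : ρ'.PosSemidef) :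
    ∃ M M' : Matrix n (n ⊕ n) ℂ, M * Mᴴ = ρ ∧ M' * M'ᴴ = ρ' ∧
      (M'ᴴ * M).trace = fidelity ρ ρ' := by
  obtain ⟨R, V, hR, hF, -, hVY, hV⟩ := exists_polar_of_fidelity ρ hρ'
  -- V need not be unitary: the extra block 1 - VV† makes the row (V, 1 - VV†) a coisometry, and the
  -- zero block keeps it out of the overlap.
  refine ⟨fromCols (CFC.sqrt ρ) 0, fromCols (CFC.sqrt ρ' * V) (CFC.sqrt ρ' * (1 - V * Vᴴ)),
    ?_, ?_, ?_⟩
  · rw [conjTranspose_fromCols_eq_fromRows_conjTranspose, fromCols_mul_fromRows,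
      conjTranspose_sqrt, CFC.sqrt_mul_sqrt_self ρ hρ.nonneg]
    simp
  · rw [conjTranspose_fromCols_eq_fromRows_conjTranspose, fromCols_mul_fromRows,
      conjTranspose_mul, conjTranspose_mul, conjTranspose_sqrt, conjTranspose_sub,
      conjTranspose_one, conjTranspose_mul, conjTranspose_conjTranspose]
    have h : V * Vᴴ + (1 - V * Vᴴ) * (1 - V * Vᴴ) = 1 := by
      have h2 : V * Vᴴ * (V * Vᴴ) = V * Vᴴ := by rw [← mul_assoc, hV]
      rw [mul_sub, mul_one, sub_mul, one_mul, h2, sub_self, sub_zero, add_sub_cancel]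
    calc CFC.sqrt ρ' * V * (Vᴴ * CFC.sqrt ρ') +
          CFC.sqrt ρ' * (1 - V * Vᴴ) * ((1 - V * Vᴴ) * CFC.sqrt ρ')
        = CFC.sqrt ρ' * (V * Vᴴ + (1 - V * Vᴴ) * (1 - V * Vᴴ)) * CFC.sqrt ρ' := by
          simp only [mul_add, add_mul, mul_assoc]
      _ = ρ' := by rw [h, mul_one, CFC.sqrt_mul_sqrt_self ρ' hρ'.nonneg]
  · rw [trace_mul_comm, conjTranspose_fromCols_eq_fromRows_conjTranspose, fromCols_mul_fromRows,
      Matrix.zero_mul, add_zero, conjTranspose_mul, conjTranspose_sqrt, trace_mul_comm, mul_assoc,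
      hVY, hF]

/-- The overlap of two purifications is bounded by the largest overlap of unit vectors in the
ranges of the two states. -/
theorem norm_trace_le_maxOverlap {ρ ρ' : Matrix n n ℂ} (hρ : IsState ρ) (hρ' : IsState ρ')
    {c : ℝ} (hc : IsMaxOverlap (rangeOf ρ) (rangeOf ρ') c) {M M' : Matrix n κ ℂ}
    (hM : M * Mᴴ = ρ) (hM' : M' * M'ᴴ = ρ') : ‖(M'ᴴ * M).trace‖ ≤ c := by
  obtain ⟨P, hP, hPP, hPρ, hPU⟩ := exists_support hρ.1.1
  obtain ⟨Q, hQ, hQQ, hQρ, hQV⟩ := exists_support hρ'.1.1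
  obtain ⟨C, hC, hC1⟩ := exists_contraction hc hP hPP hQ hQQ hPU hQV
  have key : ∀ {R : Matrix n n ℂ} {N : Matrix n κ ℂ}, R * (N * Nᴴ) = N * Nᴴ → R * N = N := by
    intro R N h
    have : (R - 1) * N = 0 := by
      rw [← mul_self_mul_conjTranspose_eq_zero, Matrix.sub_mul, h, Matrix.one_mul, sub_self]
    rwa [Matrix.sub_mul, Matrix.one_mul, sub_eq_zero] at this
  have hPM : P * M = M := key (by rw [hM, hPρ])
  have hQM : Q * M' = M' := key (by rw [hM', hQρ])
  -- Inserting the supports gives M'†M = M'†QPM with QP = cC; then M' and CM have Hilbert-Schmidt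
  -- norm at most 1.
  have h1 : M'ᴴ * M = (c : ℂ) • (M'ᴴ * (C * M)) := by
    nth_rw 1 [← hPM, ← hQM]
    rw [conjTranspose_mul, hQ, Matrix.mul_assoc, ← Matrix.mul_assoc Q, ← hC, Matrix.smul_mul,
      Matrix.mul_smul]
  have h2 := norm_trace_conjTranspose_mul_le M' (C * M)
  have h3 : (M'ᴴ * M').trace.re = 1 := by rw [trace_mul_comm, hM', hρ'.2]; rfl
  have h4 : (Mᴴ * M).trace.re = 1 := by rw [trace_mul_comm, hM, hρ.2]; rfl
  have h5 := (Complex.le_def.1 (hC1.conjTranspose_mul_mul_same M).trace_nonneg).1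
  rw [Matrix.mul_sub, Matrix.sub_mul, Matrix.mul_one, trace_sub, Complex.sub_re, h4] at h5
  have h6 : (C * M)ᴴ * (C * M) = Mᴴ * (Cᴴ * C) * M := by
    rw [conjTranspose_mul]; simp only [Matrix.mul_assoc]
  rw [h6] at h2
  rw [h1, trace_smul, norm_smul, Complex.norm_real, Real.norm_of_nonneg hc.nonneg]
  refine mul_le_of_le_one_right hc.nonneg ?_
  simp only [Complex.zero_re] at h5
  linarith

theorem fidelity_le {ρ ρ' : Matrix n n ℂ} (hρ : IsState ρ) (hρ' : IsState ρ')
    {c : ℝ} (hc : IsMaxOverlap (rangeOf ρ) (rangeOf ρ') c) : fidelity ρ ρ' ≤ c := by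
  obtain ⟨M, M', hM, hM', h⟩ := exists_trace_eq_fidelity hρ.1 hρ'.1
  have := norm_trace_le_maxOverlap hρ hρ' hc hM hM'
  rwa [h, Complex.norm_real, Real.norm_of_nonneg (fidelity_nonneg hρ'.1)] at this

end Uhlmann

/-! ### Bipartite vectors as matrices. -/

section Vectorization

variable {n κ : Type*} [Fintype n] [Fintype κ]

/-- The matrix of coefficients of a vector of a bipartite system. -/
def coeffMatrix (Ψ : EuclideanSpace ℂ (n × κ)) : Matrix n κ ℂ := Matrix.of fun i s => Ψ (i, s)

omit [Fintype n] in
theorem trAux_proj (Ψ : EuclideanSpace ℂ (n × κ)) :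
    trAux (proj Ψ) = coeffMatrix Ψ * (coeffMatrix Ψ)ᴴ := by
  ext i j
  simp [trAux, proj, coeffMatrix, vecMulVec_apply, mul_apply]

theorem inner_eq_trace_coeffMatrix (Ψ Φ : EuclideanSpace ℂ (n × κ)) :
    inner ℂ Ψ Φ = ((coeffMatrix Ψ)ᴴ * coeffMatrix Φ).trace := by
  rw [EuclideanSpace.inner_eq_star_dotProduct]
  simp only [dotProduct, trace, diag_apply, mul_apply, conjTranspose_apply, coeffMatrix, of_apply,
    Fintype.sum_prod_type]
  rw [Finset.sum_comm]
  exact Finset.sum_congr rfl fun _ _ => Finset.sum_congr rfl fun _ _ => mul_comm _ _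

theorem norm_eq_one_of_trAux_proj {Ψ : EuclideanSpace ℂ (n × κ)}
    (h : (trAux (proj Ψ)).trace = 1) : ‖Ψ‖ = 1 := by
  rw [trace_trAux, trace_proj] at h
  have : ‖Ψ‖ ^ 2 = 1 := by exact_mod_cast h
  exact (pow_eq_one_iff_of_nonneg (norm_nonneg _) two_ne_zero).1 this

/-- Uhlmann's theorem: some pair of purifications has the fidelity as its overlap. -/
theorem exists_purifications [DecidableEq n] {ρ ρ' : Matrix n n ℂ} (hρ : IsState ρ)
    (hρ' : IsState ρ') : ∃ (d : ℕ) (Ψ Ψ' : EuclideanSpace ℂ (n × Fin d)), ‖Ψ‖ = 1 ∧ ‖Ψ'‖ = 1 ∧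
      trAux (proj Ψ) = ρ ∧ trAux (proj Ψ') = ρ' ∧ inner ℂ Ψ Ψ' = (fidelity ρ ρ' : ℂ) := by
  obtain ⟨M, M', hM, hM', h⟩ := exists_trace_eq_fidelity hρ.1 hρ'.1
  set e := (Fintype.equivFin (n ⊕ n)).symm with he
  let v : Matrix n (n ⊕ n) ℂ → EuclideanSpace ℂ (n × Fin (Fintype.card (n ⊕ n))) :=
    fun N => WithLp.toLp 2 fun p => N p.1 (e p.2)
  have hv : ∀ N, coeffMatrix (v N) = N.submatrix id e := fun N => rfl
  have hN : ∀ N, trAux (proj (v N)) = N * Nᴴ := fun N => by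
    rw [trAux_proj, hv, conjTranspose_submatrix, submatrix_mul_equiv, submatrix_id_id]
  have h1 : trAux (proj (v M)) = ρ := by rw [hN, hM]
  have h2 : trAux (proj (v M')) = ρ' := by rw [hN, hM']
  refine ⟨_, v M, v M', norm_eq_one_of_trAux_proj (by rw [h1, hρ.2]),
    norm_eq_one_of_trAux_proj (by rw [h2, hρ'.2]), h1, h2, ?_⟩
  have h3 : inner ℂ (v M') (v M) = (fidelity ρ ρ' : ℂ) := by
    rw [inner_eq_trace_coeffMatrix, hv, hv, trace_mul_comm, conjTranspose_submatrix,
      submatrix_mul_equiv, submatrix_id_id, trace_mul_comm, h]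
  rw [← inner_conj_symm, h3, Complex.conj_ofReal]

end Vectorization

/-! ### Constraints on purifiers, and their construction. -/

section Purifier

variable {m n : Type*} [Fintype m] [DecidableEq m] [Fintype n] [DecidableEq n]

theorem proj_toEuclideanLin (X : Matrix n n ℂ) (x : EuclideanSpace ℂ n) :
    proj (toEuclideanLin X x) = X * proj x * Xᴴ := by
  rw [proj, proj, toLpLin_apply, mul_vecMulVec, vecMulVec_mul, ← star_mulVec]

theorem posSemidef_norm_sq_sub_proj (y : EuclideanSpace ℂ n) :
    (((‖y‖ ^ 2 : ℝ) : ℂ) • 1 - proj y).PosSemidef := by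
  have hH : (((‖y‖ ^ 2 : ℝ) : ℂ) • (1 : Matrix n n ℂ)).IsHermitian := by
    rw [IsHermitian, conjTranspose_smul, conjTranspose_one, Complex.star_def, Complex.conj_ofReal]
  refine .of_dotProduct_mulVec_nonneg (hH.sub (proj_posSemidef y).1) fun x => ?_
  have h2 := star_dotProduct_self (WithLp.toLp 2 x)
  have h3 : star y.ofLp ⬝ᵥ x = inner ℂ y (WithLp.toLp 2 x) := by
    rw [dotProduct_comm, EuclideanSpace.inner_eq_star_dotProduct]
  have h4 : star x ⬝ᵥ y.ofLp = inner ℂ (WithLp.toLp 2 x) y := by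
    rw [dotProduct_comm, EuclideanSpace.inner_eq_star_dotProduct]
  have h5 : star x ⬝ᵥ proj y *ᵥ x = ((‖inner ℂ y (WithLp.toLp 2 x)‖ ^ 2 : ℝ) : ℂ) := by
    rw [proj, vecMulVec_mulVec, h3, dotProduct_smul, h4, op_smul_eq_smul, smul_eq_mul,
      ← inner_conj_symm (WithLp.toLp 2 x) y, Complex.mul_conj']
    push_cast
    rfl
  rw [sub_mulVec, dotProduct_sub, smul_mulVec, one_mulVec, dotProduct_smul, h2, h5, smul_eq_mul,
    ← Complex.ofReal_mul, ← Complex.ofReal_sub, Complex.zero_le_real, sub_nonneg, ← mul_pow]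
  exact pow_le_pow_left₀ (norm_nonneg _) (norm_inner_le_norm _ _) 2

/-- A unit vector in the range of a positive operator is dominated by a multiple of it. -/
theorem exists_proj_le_smul {ρ : Matrix n n ℂ} (hρ : ρ.PosSemidef) {χ : EuclideanSpace ℂ n}
    (hχ : χ ∈ rangeOf ρ) (hχ0 : χ ≠ 0) :
    ∃ t : ℝ, 0 < t ∧ (ρ - (t : ℂ) • proj χ).PosSemidef := by
  obtain ⟨x, rfl⟩ := hχ
  set s := CFC.sqrt ρ with hs
  have hsH : sᴴ = s := conjTranspose_sqrt ρ
  have hss : s * s = ρ := CFC.sqrt_mul_sqrt_self ρ hρ.nonneg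
  -- With χ = ρx = sy, conjugating |y⟩⟨y| ≤ ‖y‖² by s gives |χ⟩⟨χ| ≤ ‖y‖² ρ.
  set y := toEuclideanLin s x with hy
  have hsy : toEuclideanLin ρ x = toEuclideanLin s y := by
    rw [← hss, hy]; simp [toLpLin_apply, mulVec_mulVec]
  have hy0 : y ≠ 0 := by
    intro h
    rw [hsy, h, map_zero] at hχ0
    exact hχ0 rfl
  have hn : 0 < ‖y‖ ^ 2 := by positivity
  refine ⟨(‖y‖ ^ 2)⁻¹, inv_pos.2 hn, ?_⟩
  have h1 := ((posSemidef_norm_sq_sub_proj y).mul_mul_conjTranspose_same s).smul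
    (Complex.zero_le_real.2 (inv_pos.2 hn).le)
  convert h1 using 1
  rw [hsy, proj_toEuclideanLin, Matrix.mul_sub, Matrix.sub_mul, Matrix.mul_smul, Matrix.mul_one,
    Matrix.smul_mul, hsH, hss, smul_sub, smul_smul, ← Complex.ofReal_mul,
    inv_mul_cancel₀ hn.ne', Complex.ofReal_one, one_smul]

/-- A channel with a pure output on `ρ` has the same output on every pure state in its range. -/
theorem channel_proj_eq {Λ : Matrix n n ℂ →CP Matrix m m ℂ} (hΛ : IsTracePreserving Λ)
    {ρ : Matrix n n ℂ} (hρ : ρ.PosSemidef) {Ψ : EuclideanSpace ℂ m} (hΨ : ‖Ψ‖ = 1)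
    (h : Λ ρ = proj Ψ) {χ : EuclideanSpace ℂ n} (hχ : χ ∈ rangeOf ρ) (hχ1 : ‖χ‖ = 1) :
    Λ (proj χ) = proj Ψ := by
  obtain ⟨t, ht, htρ⟩ := exists_proj_le_smul hρ hχ (norm_ne_zero_iff.1 (by rw [hχ1]; simp))
  have h1 := map_posSemidef Λ htρ
  rw [map_sub, h] at h1
  have h2 := map_posSemidef Λ ((proj_posSemidef χ).smul (Complex.zero_le_real.2 ht.le))
  have h3 := eq_smul_proj_of_le hΨ h2 h1
  rw [hΛ, trace_smul, trace_proj, hχ1, map_smul] at h3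
  have ht' : (t : ℂ) ≠ 0 := Complex.ofReal_ne_zero.2 ht.ne'
  refine smul_right_injective _ ht' ?_
  simpa using h3

/-- The closest pure states of the two ranges are sent to Ψ and Ψ', and channels do not increase
distance. -/
theorem maxOverlap_le_of_channel {Λ : Matrix n n ℂ →CP Matrix m m ℂ} (hΛ : IsTracePreserving Λ)
    {ρ ρ' : Matrix n n ℂ} (hρ : ρ.PosSemidef) (hρ' : ρ'.PosSemidef) {c : ℝ}
    (hc : IsMaxOverlap (rangeOf ρ) (rangeOf ρ') c) {Ψ Ψ' : EuclideanSpace ℂ m} (hΨ : ‖Ψ‖ = 1)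
    (hΨ' : ‖Ψ'‖ = 1) (h : Λ ρ = proj Ψ) (h' : Λ ρ' = proj Ψ') : c ≤ ‖inner ℂ Ψ Ψ'‖ := by
  obtain ⟨u, hu, v, hv, hu1, hv1, huv⟩ := hc.exists_eq
  have h1 := traceDist_channel_le hΛ ((proj_posSemidef u).1.sub (proj_posSemidef v).1)
  rw [channel_proj_eq hΛ hρ hΨ h hu hu1, channel_proj_eq hΛ hρ' hΨ' h' hv hv1,
    traceDist_proj hΨ hΨ', traceDist_proj hu1 hv1, huv,
    Real.sqrt_le_sqrt_iff (by nlinarith [hc.nonneg, hc.le_one])] at h1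
  exact le_of_sq_le_sq (by linarith) (norm_nonneg _)

theorem maxOverlap_le_fidelity_of_purifier {ρ ρ' : Matrix n n ℂ} (hρ : IsState ρ)
    (hρ' : IsState ρ') {c : ℝ} (hc : IsMaxOverlap (rangeOf ρ) (rangeOf ρ') c)
    (h : AdmitsPerfectPurifier {ρ, ρ'}) :
    c ≤ fidelity ρ ρ' ∧ traceDist ρ ρ' ≤ √(1 - c ^ 2) := by
  obtain ⟨d, Λ, hΛ, hM⟩ := h
  obtain ⟨⟨Ψ, hΨ, h1⟩, h2⟩ := hM ρ (by simp)
  obtain ⟨⟨Ψ', hΨ', h1'⟩, h2'⟩ := hM ρ' (by simp)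
  have hc1 := maxOverlap_le_of_channel hΛ hρ.1 hρ'.1 hc hΨ hΨ' h1 h1'
  constructor
  · have h3 := norm_trace_le_fidelity hρ.1 hρ'.1 (M := coeffMatrix Ψ) (M' := coeffMatrix Ψ')
      (by rw [← trAux_proj, ← h1, h2]) (by rw [← trAux_proj, ← h1', h2'])
    rw [← inner_eq_trace_coeffMatrix, norm_inner_symm] at h3
    exact hc1.trans h3
  · have h3 := traceDist_trAux_le ((proj_posSemidef Ψ).1.sub (proj_posSemidef Ψ').1)
    rw [← h1, ← h1', h2, h2', h1, h1', traceDist_proj hΨ hΨ'] at h3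
    refine h3.trans (Real.sqrt_le_sqrt ?_)
    have := pow_le_pow_left₀ hc.nonneg hc1 2
    linarith

/-- A perfect purifier exists once the fidelity equals the largest overlap. -/
theorem admitsPerfectPurifier_of_fidelity_eq {ρ ρ' : Matrix n n ℂ} (hρ : IsState ρ)
    (hρ' : IsState ρ') {c : ℝ} (hc : IsMaxOverlap (rangeOf ρ) (rangeOf ρ') c)
    (h : fidelity ρ ρ' = c) : AdmitsPerfectPurifier {ρ, ρ'} := by
  obtain ⟨d, Ψ, Ψ', hΨ, hΨ', h1, h1', hi⟩ := exists_purifications hρ hρ'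
  rw [h] at hi
  obtain ⟨Λ, hΛ, h2, h2'⟩ := exists_channel hρ hρ' hc hΨ hΨ' hi
  refine ⟨d, Λ, hΛ, fun σ hσ => ?_⟩
  rcases hσ with rfl | rfl
  · exact ⟨⟨Ψ, hΨ, h2⟩, by rw [h2, h1]⟩
  · exact ⟨⟨Ψ', hΨ', h2'⟩, by rw [h2', h1']⟩

/-- Optimal purifications Ψ, Ψ' are at angle β. Replacing Ψ by a vector Φ of their plane at angle α
from Ψ' makes the pair reachable. Then ρ' is reproduced exactly, and ρ up to the distance sin(β - α)
between Ψ and Φ. -/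
theorem optDeviation_le {ρ ρ' : Matrix n n ℂ} (hρ : IsState ρ)
    (hρ' : IsState ρ') {c : ℝ} (hc : IsMaxOverlap (rangeOf ρ) (rangeOf ρ') c) {η η' : ℝ}
    (hη : 0 ≤ η) (hη' : 0 ≤ η') :
    optDeviation η η' ρ ρ' ≤ η * Real.sin (Real.arccos (fidelity ρ ρ') - Real.arccos c) := by
  obtain ⟨d, Ψ, Ψ', hΨ, hΨ', h1, h1', hi⟩ := exists_purifications hρ hρ'
  set F := fidelity ρ ρ' with hF
  have hF0 : 0 ≤ F := fidelity_nonneg hρ'.1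
  have hFc : F ≤ c := fidelity_le hρ hρ' hc
  have hc1 := hc.le_one
  have hF1 : 0 ≤ 1 - F ^ 2 := by nlinarith
  have hs1 : 0 ≤ 1 - c ^ 2 := by nlinarith [hc.nonneg]
  have hq : √(1 - F ^ 2) ^ 2 = 1 - F ^ 2 := Real.sq_sqrt hF1
  have hs : √(1 - c ^ 2) ^ 2 = 1 - c ^ 2 := Real.sq_sqrt hs1
  -- A = sin α / sin β. If F = 1 then c = 1, and division by zero gives A = 0, so Φ = Ψ'.
  set A := √(1 - c ^ 2) / √(1 - F ^ 2) with hA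
  have hAq : A * √(1 - F ^ 2) = √(1 - c ^ 2) := by
    rcases eq_or_ne √(1 - F ^ 2) 0 with h0 | h0
    · have h2 : 1 - c ^ 2 ≤ 1 - F ^ 2 := by nlinarith
      have h3 := Real.sqrt_le_sqrt h2
      rw [h0] at h3
      rw [h0, mul_zero, le_antisymm h3 (Real.sqrt_nonneg _)]
    · rw [hA, div_mul_cancel₀ _ h0]
  set B := c - A * F with hB
  set Φ : EuclideanSpace ℂ (n × Fin d) := (A : ℂ) • Ψ + (B : ℂ) • Ψ' with hΦdef
  have hi' : inner ℂ Ψ' Ψ = (F : ℂ) := by rw [← inner_conj_symm, hi, Complex.conj_ofReal]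
  have hii : inner ℂ Ψ Ψ = (1 : ℂ) := by rw [inner_self_eq_norm_sq_to_K, hΨ]; simp
  have hii' : inner ℂ Ψ' Ψ' = (1 : ℂ) := by rw [inner_self_eq_norm_sq_to_K, hΨ']; simp
  have hΦ' : inner ℂ Φ Ψ' = (c : ℂ) := by
    rw [hΦdef, inner_add_left, inner_smul_left, inner_smul_left, hi, hii', Complex.conj_ofReal,
      Complex.conj_ofReal, hB]
    push_cast; ring
  have hΨΦ : inner ℂ Ψ Φ = ((F * c + √(1 - F ^ 2) * √(1 - c ^ 2) : ℝ) : ℂ) := by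
    have : F * c + √(1 - F ^ 2) * √(1 - c ^ 2) = A + B * F := by
      rw [← hAq, hB]; linear_combination A * hq
    rw [this, hΦdef, inner_add_right, inner_smul_right, inner_smul_right, hi, hii]
    push_cast; ring
  have hΦ1 : ‖Φ‖ = 1 := by
    have h2 : ((‖Φ‖ ^ 2 : ℝ) : ℂ) = ((1 : ℝ) : ℂ) := by
      have h3 : ((‖Φ‖ ^ 2 : ℝ) : ℂ) = inner ℂ Φ Φ := by
        rw [inner_self_eq_norm_sq_to_K]; norm_cast
      have h4 : (1 : ℝ) = A * (A + B * F) + B * c := by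
        rw [hB]; linear_combination (-1 : ℝ) * hs + A ^ 2 * hq -
          (A * √(1 - F ^ 2) + √(1 - c ^ 2)) * hAq
      have h5 : inner ℂ Φ Ψ = ((A + B * F : ℝ) : ℂ) := by
        rw [hΦdef, inner_add_left, inner_smul_left, inner_smul_left, hi', hii,
          Complex.conj_ofReal, Complex.conj_ofReal]
        push_cast; ring
      rw [h3]
      nth_rw 2 [hΦdef]
      rw [inner_add_right, inner_smul_right, inner_smul_right, hΦ', h5, h4]
      push_cast; ring
    rw [Complex.ofReal_inj] at h2
    exact (pow_eq_one_iff_of_nonneg (norm_nonneg _) two_ne_zero).1 h2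
  obtain ⟨Λ, hΛ, h2, h2'⟩ := exists_channel hρ hρ' hc hΦ1 hΨ' hΦ'
  have hbdd : BddBelow {δ | ∃ (d : ℕ) (Λ : Matrix n n ℂ →CP Matrix (n × Fin d) (n × Fin d) ℂ),
      IsTracePreserving Λ ∧ IsPureState (Λ ρ) ∧ IsPureState (Λ ρ') ∧
        δ = deviation Λ η η' ρ ρ'} := by
    refine ⟨0, ?_⟩
    rintro δ ⟨d, Λ, -, -, -, rfl⟩
    exact add_nonneg (mul_nonneg hη (traceDist_nonneg _ _))
      (mul_nonneg hη' (traceDist_nonneg _ _))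
  refine (csInf_le hbdd ⟨d, Λ, hΛ, ⟨Φ, hΦ1, h2⟩, ⟨Ψ', hΨ', h2'⟩, rfl⟩).trans ?_
  have h0 : traceDist ρ' ρ' = 0 := by simp [traceDist]
  rw [deviation, h2, h2', h1', h0, mul_zero, add_zero]
  refine mul_le_mul_of_nonneg_left ?_ hη
  have h3 := traceDist_trAux_le ((proj_posSemidef Ψ).1.sub (proj_posSemidef Φ).1)
  rw [h1, traceDist_proj hΨ hΦ1, hΨΦ, Complex.norm_real, Real.norm_eq_abs, sq_abs] at h3
  refine h3.trans (le_of_eq ?_)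
  have hcos : F * c + √(1 - F ^ 2) * √(1 - c ^ 2) =
      Real.cos (Real.arccos F - Real.arccos c) := by
    rw [Real.cos_sub, Real.cos_arccos (by linarith) (by linarith),
      Real.cos_arccos (by linarith [hc.nonneg]) hc1, Real.sin_arccos, Real.sin_arccos]
  rw [hcos, ← Real.sin_sq, Real.sqrt_sq]
  refine Real.sin_nonneg_of_nonneg_of_le_pi (sub_nonneg.2 (Real.arccos_le_arccos hFc)) ?_
  linarith [Real.arccos_le_pi F, Real.arccos_nonneg c]

end Purifier

/-! ### The lower bound on the trace distance and its equality case. -/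

section TraceDistanceBound

variable {n κ : Type*} [Fintype n] [DecidableEq n] [Fintype κ] [DecidableEq κ]

/-- The Pauli matrix `σ_z` on a qubit, tensored with the identity. -/
def pauliZ (κ : Type*) [DecidableEq κ] : Matrix (Fin 2 × κ) (Fin 2 × κ) ℂ :=
  diagonal fun p => if p.1 = 0 then 1 else -1

omit [Fintype κ] in
theorem one_sub_pauliZ_posSemidef : (1 - pauliZ κ).PosSemidef := by
  rw [pauliZ, ← diagonal_one, diagonal_sub]
  refine PosSemidef.diagonal fun p => ?_
  by_cases h : p.1 = 0 <;> (simp [h]; try norm_num)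

omit [Fintype κ] in
theorem one_add_pauliZ_posSemidef : (1 + pauliZ κ).PosSemidef := by
  rw [pauliZ, ← diagonal_one, diagonal_add]
  refine PosSemidef.diagonal fun p => ?_
  by_cases h : p.1 = 0 <;> (simp [h]; try norm_num)

/-- The qubit vector with real coordinates `x` and `y`. -/
def qubit (x y : ℝ) : EuclideanSpace ℂ (Fin 2) := !₂[(x : ℂ), (y : ℂ)]

theorem norm_qubit {x y : ℝ} (h : x ^ 2 + y ^ 2 = 1) : ‖qubit x y‖ = 1 := by
  rw [EuclideanSpace.norm_eq]
  simp [qubit, h]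

theorem inner_qubit (x y : ℝ) : inner ℂ (qubit x y) (qubit y x) = ((2 * (x * y) : ℝ) : ℂ) := by
  rw [EuclideanSpace.inner_eq_star_dotProduct]
  simp [qubit, dotProduct]
  ring

theorem trace_pauliZ_mul (x y : ℝ) (r : Matrix κ κ ℂ) :
    (pauliZ κ * (proj (qubit x y) ⊗ₖ r)).trace = ((x ^ 2 - y ^ 2 : ℝ) : ℂ) * r.trace := by
  simp only [pauliZ, trace, diag_apply, diagonal_mul, kroneckerMap_apply, Fintype.sum_prod_type,
    Fin.sum_univ_two, proj, vecMulVec_apply, qubit]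
  simp [← Finset.mul_sum]
  ring

/-- The trace distance is at least the worst-case distinguishability, and equality forces the
fidelity to attain the largest overlap. -/
theorem traceDist_ge {ρ ρ' : Matrix n n ℂ} (hρ : IsState ρ)
    (hρ' : IsState ρ') {c : ℝ} (hc : IsMaxOverlap (rangeOf ρ) (rangeOf ρ') c) :
    √(1 - c ^ 2) ≤ traceDist ρ ρ' ∧ (traceDist ρ ρ' ≤ √(1 - c ^ 2) → c ≤ fidelity ρ ρ') := by
  have hc1 := hc.le_one
  have hc0 := hc.nonneg
  have hs1 : 0 ≤ 1 - c ^ 2 := by nlinarith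
  set s := √(1 - c ^ 2) with hs
  have hss : s ^ 2 = 1 - c ^ 2 := Real.sq_sqrt hs1
  have hs0 : 0 ≤ s := Real.sqrt_nonneg _
  have hs2 : s ≤ 1 := by nlinarith
  -- Chosen so that the qubit vectors (x, y) and (y, x) have overlap 2xy = c and σ_z expectations
  -- ±(x² - y²) = ±s.
  set x := √((1 + s) / 2) with hx
  set y := √((1 - s) / 2) with hy
  have hx2 : x ^ 2 = (1 + s) / 2 := Real.sq_sqrt (by linarith)
  have hy2 : y ^ 2 = (1 - s) / 2 := Real.sq_sqrt (by linarith)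
  have hxy : 2 * (x * y) = c := by
    have h1 : (2 * (x * y)) ^ 2 = c ^ 2 := by
      rw [mul_pow, mul_pow, hx2, hy2]; linear_combination -hss
    exact (pow_left_inj₀ (by positivity) hc0 two_ne_zero).1 h1
  have hφ : ‖qubit x y‖ = 1 := norm_qubit (by rw [hx2, hy2]; ring)
  have hφ' : ‖qubit y x‖ = 1 := norm_qubit (by rw [hx2, hy2]; ring)
  obtain ⟨W, r, r', hW, hr, hr', h1, h1'⟩ :=
    exists_dilation hρ hρ' hc hφ hφ' (by rw [inner_qubit, hxy])
  set Δ := W * ρ * Wᴴ - W * ρ' * Wᴴ with hΔ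
  have hΔH : Δ.IsHermitian :=
    (hρ.1.mul_mul_conjTranspose_same W).1.sub (hρ'.1.mul_mul_conjTranspose_same W).1
  have htr : (pauliZ _ * Δ).trace.re = 2 * s := by
    rw [hΔ, h1, h1', Matrix.mul_sub, trace_sub, trace_pauliZ_mul, trace_pauliZ_mul, hr.2, hr'.2,
      mul_one, mul_one, ← Complex.ofReal_sub, Complex.ofReal_re, hx2, hy2]
    ring
  have h2 := re_trace_mul_le_abs hΔH one_sub_pauliZ_posSemidef one_add_pauliZ_posSemidef
  have h3 := traceDist_conj_le hW (hρ.1.1.sub hρ'.1.1)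
  have h4 : (CFC.abs Δ).trace.re ≤ 2 * traceDist ρ ρ' := by
    rw [traceDist, ← hΔ] at h3
    linarith
  refine ⟨by linarith, fun hle => ?_⟩
  rcases hc0.eq_or_lt with h0 | h0
  · rw [← h0]; exact fidelity_nonneg hρ'.1
  have h5 := mul_eq_abs_of_re_trace_eq hΔH one_sub_pauliZ_posSemidef one_add_pauliZ_posSemidef
    (by linarith)
  -- Thus σ_z commutes with Δ, so the off-diagonal block xy(r - r') of Δ vanishes; c > 0 gives xy ≠
  -- 0.
  have h6 : (pauliZ _ * Δ)ᴴ = pauliZ _ * Δ := by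
    rw [h5]; exact (nonneg_iff_posSemidef.1 (CFC.abs_nonneg Δ)).1
  have hrr : r = r' := by
    ext k l
    have e1 := congrFun (congrFun h6 (0, k)) (1, l)
    have e2 : Δ (0, k) (1, l) = (x * y : ℝ) * (r k l - r' k l) := by
      rw [hΔ, h1, h1', Matrix.sub_apply, kroneckerMap_apply, kroneckerMap_apply]
      simp [proj, vecMulVec_apply, qubit]
      ring
    have e3 : star (Δ (1, l) (0, k)) = Δ (0, k) (1, l) := hΔH.apply _ _
    rw [conjTranspose_apply, pauliZ, diagonal_mul, diagonal_mul] at e1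
    simp only [one_ne_zero, if_false, if_true, one_mul, neg_mul, star_neg, e3] at e1
    have e4 : Δ (0, k) (1, l) = 0 := by linear_combination (-1 / 2 : ℂ) * e1
    rw [e2, mul_eq_zero] at e4
    rcases e4 with e4 | e4
    · rw [Complex.ofReal_eq_zero] at e4
      rw [e4, mul_zero] at hxy
      exact absurd hxy h0.ne
    · exact sub_eq_zero.1 e4
  obtain ⟨N, hN⟩ := exists_eq_mul_conjTranspose hr.1
  -- Pulling φ ⊗ N back through W purifies σ, and loses nothing because its columns lie in the range
  -- of W. The two purifications share N, so their overlap is c tr r = c.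
  have key : ∀ {φ : EuclideanSpace ℂ (Fin 2)} {σ : Matrix n n ℂ}, W * σ * Wᴴ = proj φ ⊗ₖ r →
      (Wᴴ * ketTensor φ N) * (Wᴴ * ketTensor φ N)ᴴ = σ ∧
        W * (Wᴴ * ketTensor φ N) = ketTensor φ N := by
    intro φ σ hσ
    rw [hN, ← ketTensor_mul_conjTranspose] at hσ
    constructor
    · calc Wᴴ * ketTensor φ N * (Wᴴ * ketTensor φ N)ᴴ
          = Wᴴ * (ketTensor φ N * (ketTensor φ N)ᴴ) * W := by
            rw [conjTranspose_mul, conjTranspose_conjTranspose]; simp only [Matrix.mul_assoc]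
        _ = (Wᴴ * W) * σ * (Wᴴ * W) := by rw [← hσ]; simp only [Matrix.mul_assoc]
        _ = σ := by rw [hW, Matrix.one_mul, Matrix.mul_one]
    · have : (W * Wᴴ - 1) * ketTensor φ N = 0 := by
        rw [← mul_self_mul_conjTranspose_eq_zero, ← hσ, Matrix.sub_mul, Matrix.one_mul]
        have : W * Wᴴ * (W * σ * Wᴴ) = W * (Wᴴ * W) * σ * Wᴴ := by simp only [Matrix.mul_assoc]
        rw [this, hW, Matrix.mul_one, sub_self]
      rwa [Matrix.sub_mul, Matrix.one_mul, sub_eq_zero, Matrix.mul_assoc] at this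
  obtain ⟨k1, k2⟩ := key h1
  obtain ⟨k1', -⟩ := key (h1'.trans (by rw [hrr]))
  have h7 := norm_trace_le_fidelity hρ.1 hρ'.1 k1 k1'
  rw [conjTranspose_mul, conjTranspose_conjTranspose, Matrix.mul_assoc, k2,
    conjTranspose_ketTensor_mul, inner_qubit, mul_comm y x, hxy, trace_smul, trace_mul_comm, ← hN,
    hr.2, smul_eq_mul, mul_one, Complex.norm_real, Real.norm_of_nonneg hc0] at h7
  exact h7

end TraceDistanceBound

/-! ### The bound in terms of c, and the conclusion. -/

theorem fidelityBound_eq {n : Type*} [Fintype n] [DecidableEq n] {ρ ρ' : Matrix n n ℂ} {c : ℝ}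
    (hc : IsMaxOverlap (rangeOf ρ) (rangeOf ρ') c) (η : ℝ) :
    fidelityBound η ρ ρ' = η * Real.sin (Real.arccos (fidelity ρ ρ') - Real.arccos c) := by
  rw [fidelityBound, worstCaseDist_eq hc, Real.arccos_eq_arcsin hc.nonneg]

/-- Since 0 ≤ F ≤ c ≤ 1, the angle β - α lies in [0, π/2], where the sine vanishes only at 0;
`arccos` is injective on [-1, 1]. -/
theorem fidelityBound_eq_zero_iff {n : Type*} [Fintype n] [DecidableEq n] {ρ ρ' : Matrix n n ℂ}
    (hρ : IsState ρ) (hρ' : IsState ρ') {c : ℝ}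
    (hc : IsMaxOverlap (rangeOf ρ) (rangeOf ρ') c) {η : ℝ} (hη : 0 < η) :
    fidelityBound η ρ ρ' = 0 ↔ fidelity ρ ρ' = c := by
  have hF0 : 0 ≤ fidelity ρ ρ' := fidelity_nonneg hρ'.1
  have hFc := fidelity_le hρ hρ' hc
  have hc1 := hc.le_one
  have h1 := Real.arccos_le_pi_div_two.2 hF0
  have h2 := Real.arccos_nonneg c
  have h3 := Real.arccos_le_arccos hFc
  rw [fidelityBound_eq hc, mul_eq_zero, or_iff_right hη.ne',
    Real.sin_eq_zero_iff_of_lt_of_lt (by linarith [Real.pi_pos]) (by linarith [Real.pi_pos]),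
    sub_eq_zero]
  exact Real.arccos_injOn.eq_iff ⟨by linarith, by linarith⟩ ⟨by linarith, hc1⟩

end Purification

theorem mainTheorem2 {n : Type*} [Fintype n] [DecidableEq n] (ρ ρ' : Matrix n n ℂ)
    (hρ : Purification.IsState ρ) (hρ' : Purification.IsState ρ') :
    -- the minimum defining `D` is attained, and is the sine of the smallest canonical angle
    IsLeast (Purification.pureDistances ρ ρ') (Purification.worstCaseDist ρ ρ') ∧
    Purification.worstCaseDist ρ ρ' =
      Real.sin (Purification.canonicalAngle (Purification.rangeOf ρ) (Purification.rangeOf ρ') 0) ∧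
    -- the operational test
    (Purification.AdmitsPerfectPurifier {ρ, ρ'} ↔
      Purification.traceDist ρ ρ' = Purification.worstCaseDist ρ ρ') ∧
    -- the fidelity upper bound vanishes exactly in this case
    (∀ η η' : ℝ, 0 < η → η ≤ η' → η + η' = 1 →
      Purification.optDeviation η η' ρ ρ' ≤ Purification.fidelityBound η ρ ρ' ∧
      (Purification.fidelityBound η ρ ρ' = 0 ↔
        Purification.AdmitsPerfectPurifier {ρ, ρ'})) := by
  obtain ⟨c, hc, hangle⟩ := Purification.exists_isMaxOverlap (Purification.rangeOf_ne_bot hρ)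
    (Purification.rangeOf_ne_bot hρ')
  have hD := Purification.worstCaseDist_eq hc
  have hFc := Purification.fidelity_le hρ hρ' hc
  obtain ⟨hlow, heq⟩ := Purification.traceDist_ge hρ hρ' hc
  have hpur : Purification.AdmitsPerfectPurifier {ρ, ρ'} ↔ Purification.fidelity ρ ρ' = c :=
    ⟨fun h => le_antisymm hFc (Purification.maxOverlap_le_fidelity_of_purifier hρ hρ' hc h).1,
      Purification.admitsPerfectPurifier_of_fidelity_eq hρ hρ' hc⟩
  refine ⟨hD ▸ Purification.isLeast_pureDistances hc, ?_, ?_, fun η η' hη hηη' _ => ⟨?_, ?_⟩⟩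
  · rw [hD, hangle, Real.sin_arccos]
  · rw [hD]
    exact ⟨fun h => le_antisymm
        (Purification.maxOverlap_le_fidelity_of_purifier hρ hρ' hc h).2 hlow,
      fun h => hpur.2 (le_antisymm hFc (heq h.le))⟩
  · rw [Purification.fidelityBound_eq hc]
    exact Purification.optDeviation_le hρ hρ' hc hη.le (hη.le.trans hηη')
  · rw [hpur]
    exact Purification.fidelityBound_eq_zero_iff hρ hρ' hc hη
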